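/- Let $\rho=e^{2\pi i/3}$ and $\tau=(1+\sqrt5)/2$. Let $\mathcal V\subset \mathrm{PGL}_3(\mathbb C)$ be the Valentiner group, generated by the classes of the matrices $$Z_1=\begin{pmatrix}1&0&0\\0&-1&0\\0&0&-1\end{pmatrix},\quad Z_2=\begin{pmatrix}-1&0&0\\0&1&0\\0&0&-1\end{pmatrix},\quad Z_3=\begin{pmatrix}-1&0&0\\0&-1&0\\0&0&1\end{pmatrix},$$ $$T_1=\begin{pmatrix}0&0&1\\1&0&0\\0&1&0\end{pmatrix},\quad T_2=\begin{pmatrix}0&0&-1\\1&0&0\\0&-1&0\end{pmatrix},\quad T_3=\begin{pmatrix}0&0&-1\\-1&0&0\\0&1&0\end{pmatrix},\quad T_4=\begin{pmatrix}0&0&1\\-1&0&0\\0&-1&0\end{pmatrix},$$ $$P=\frac12\begin{pmatrix}1&\tau^{-1}&-\tau\\ \tau^{-1}&\tau&1\\ \tau&-1&\tau^{-1}\end{pmatrix},\qquad Q=\begin{pmatrix}1&0&0\\0&0&\rho^2\\0&-\rho&0\end{pmatrix},$$ and let $\mathcal V_{3\cdot 360}\subset \mathrm{SU}_3$ be the preimage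 of $\mathcal V$ in $\mathrm{SU}_3$. A finite group $\mathcal G\subset \mathrm{GL}_n(\mathbb C)$ acts on the exterior forms $\alpha$ on $\mathbb C^n$ with polynomial coefficients by $(T\alpha)(x)=\alpha(T^{-1}x)$, i.e. $T$ acts by pull-back along $T^{-1}$. Let $\Lambda_p(\mathbb C^n)_m^{\mathcal G}$ be the space of $\mathcal G$-invariant $p$-forms whose coefficients are homogeneous polynomials of degree $m$, and let $$M(\Lambda^{\mathcal G})=\sum_{p=0}^{n}\Bigl(\sum_{m=0}^{\infty}\bigl(\dim \Lambda_p(\mathbb C^n)_m^{\mathcal G}\bigr)t^m\Bigr)s^p$$ be the exterior Molien series of $\mathcal G$. **Proposition.** For $\mathcal V_{3\cdot360}$ the exterior Molien series is $$M(\Lambda^{\mathcal V_{3\cdot360}})=\frac{1+t^{45}+(t^5+t^{11}+t^{20}+t^{26}+t^{29}+t^{44})\,s+(t+t^{16}+t^{19}+t^{25}+t^{34}+t^{40})\,s^2+(1+t^{45})\,s^3}{(1-t^6)(1-t^{12})(1-t^{30})}$$ as a formal power series, and its expansion begins $$\begin{aligned}M(\Lambda^{\mathcal V_{3\cdot360}})={}&\bigl(1+t^6+2t^{12}+2t^{18}+3t^{24}+4t^{30}+O(t^{31})\bigr)\\&+\bigl(t^5+2t^{11}+3t^{17}+t^{20}+4t^{23}+2t^{26}+6t^{29}+O(t^{30})\bigr)s\\&+\bigl(t+t^7+2t^{13}+t^{16}+3t^{19}+t^{22}+5t^{25}+2t^{28}+O(t^{29})\bigr)s^2\\&+\bigl(1+t^6+2t^{12}+2t^{18}+3t^{24}+4t^{30}+O(t^{31})\bigr)s^3.\end{aligned}$$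 -/

import Mathlib

namespace Valentiner

noncomputable section

/-! ### Polynomial exterior forms and the exterior Molien series -/

/-- The linear map `f ↦ f(A x)` on polynomials in `n` variables. -/
def linSubst {n : ℕ} (A : Matrix (Fin n) (Fin n) ℂ) :
    MvPolynomial (Fin n) ℂ →ₗ[ℂ] MvPolynomial (Fin n) ℂ :=
  (MvPolynomial.aeval
    (fun i => ∑ j, MvPolynomial.C (A i j) * MvPolynomial.X j)).toLinearMap

/-- Exterior `p`-forms on `ℂⁿ` with polynomial coefficients: alternating `p`-linear maps on `ℂⁿ`
with values in `ℂ[x₁, …, xₙ]`. -/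
abbrev PolyForm (n p : ℕ) : Type :=
  (Fin n → ℂ) [⋀^Fin p]→ₗ[ℂ] MvPolynomial (Fin n) ℂ

/-- The action `(T α)(x) = α(T⁻¹ x)` of a linear transformation on forms, that is, the pull-back of
`α` along `T⁻¹`; at the point `x` and on the vectors `v₁, …, v_p` its value is
`α_{T⁻¹ x}(T⁻¹ v₁, …, T⁻¹ v_p)`. -/
def formAct {n p : ℕ} (T : GL (Fin n) ℂ) (α : PolyForm n p) : PolyForm n p :=
  (linSubst (T⁻¹).val).compAlternatingMap (α.compLinearMap (Matrix.mulVecLin (T⁻¹).val))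

/-- The space `Λ_p(ℂⁿ)_m^G` of `G`-invariant `p`-forms whose coefficients are homogeneous
polynomials of degree `m`. -/
def invForms {n : ℕ} (G : Subgroup (GL (Fin n) ℂ)) (p m : ℕ) : Submodule ℂ (PolyForm n p) where
  carrier := {α | (∀ v, (α v).IsHomogeneous m) ∧ ∀ T ∈ G, formAct T α = α}
  zero_mem' := by
    refine ⟨fun v => MvPolynomial.isHomogeneous_zero _ _ _, fun T _ => ?_⟩
    ext v
    simp [formAct]
  add_mem' := by
    rintro α β ⟨h1, h2⟩ ⟨k1, k2⟩
    refine ⟨fun v => (h1 v).add (k1 v), fun T hT => ?_⟩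
    have e : formAct T (α + β) = formAct T α + formAct T β := by
      ext v
      simp [formAct]
    rw [e, h2 T hT, k2 T hT]
  smul_mem' := by
    rintro c α ⟨h1, h2⟩
    refine ⟨fun v => Submodule.smul_mem (MvPolynomial.homogeneousSubmodule (Fin n) ℂ m) c (h1 v),
      fun T hT => ?_⟩
    have e : formAct T (c • α) = c • formAct T α := by
      ext v
      simp [formAct]
    rw [e, h2 T hT]

/-- The exterior Molien series `∑_{p=0}^{n} (∑_{m≥0} dim Λ_p(ℂⁿ)_m^G t^m) s^p`, as a polynomial in
`s` whose coefficients are formal power series in `t`. -/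
def exteriorMolienSeries {n : ℕ} (G : Subgroup (GL (Fin n) ℂ)) : Polynomial (PowerSeries ℤ) :=
  ∑ p ∈ Finset.range (n + 1),
    Polynomial.C (PowerSeries.mk fun m => (Module.finrank ℂ (invForms G p m) : ℤ)) *
      Polynomial.X ^ p

/-! ### The Valentiner group -/

/-- The primitive cube root of unity `e^{2πi/3}`. -/
def ρ : ℂ := Complex.exp (2 * Real.pi * Complex.I / 3)

/-- The golden ratio `(1 + √5)/2`, as a complex number. -/
def τ : ℂ := ((1 + √5) / 2 : ℝ)

lemma ρ_pow_three : ρ ^ 3 = 1 := by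
  rw [ρ, ← Complex.exp_nat_mul, ← Complex.exp_two_pi_mul_I]
  congr 1
  push_cast
  ring

lemma τ_sq : τ ^ 2 = τ + 1 := by
  have h : (√5 : ℝ) ^ 2 = 5 := Real.sq_sqrt (by norm_num)
  have h' : (((1 + √5) / 2 : ℝ)) ^ 2 = (1 + √5) / 2 + 1 := by nlinarith
  unfold τ
  exact_mod_cast h'

lemma τ_inv : τ⁻¹ = τ - 1 := by
  refine inv_eq_of_mul_eq_one_right ?_
  linear_combination τ_sq

/-! The matrices `Z₁, Z₂, Z₃, T₁, T₂, T₃, T₄` generating the tetrahedral group `𝒯`. -/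

def matZ₁ : Matrix (Fin 3) (Fin 3) ℂ := !![1, 0, 0; 0, -1, 0; 0, 0, -1]
def matZ₂ : Matrix (Fin 3) (Fin 3) ℂ := !![-1, 0, 0; 0, 1, 0; 0, 0, -1]
def matZ₃ : Matrix (Fin 3) (Fin 3) ℂ := !![-1, 0, 0; 0, -1, 0; 0, 0, 1]
def matT₁ : Matrix (Fin 3) (Fin 3) ℂ := !![0, 0, 1; 1, 0, 0; 0, 1, 0]
def matT₂ : Matrix (Fin 3) (Fin 3) ℂ := !![0, 0, -1; 1, 0, 0; 0, -1, 0]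
def matT₃ : Matrix (Fin 3) (Fin 3) ℂ := !![0, 0, -1; -1, 0, 0; 0, 1, 0]
def matT₄ : Matrix (Fin 3) (Fin 3) ℂ := !![0, 0, 1; -1, 0, 0; 0, -1, 0]

/-- The transformation `P` of order five, extending the tetrahedral group to an icosahedral one. -/
def matP : Matrix (Fin 3) (Fin 3) ℂ :=
  (1 / 2 : ℂ) • !![1, τ⁻¹, -τ; τ⁻¹, τ, 1; τ, -1, τ⁻¹]

/-- The transformation `Q` of order four, extending the tetrahedral group to an octahedral one. -/
def matQ : Matrix (Fin 3) (Fin 3) ℂ := !![1, 0, 0; 0, 0, ρ ^ 2; 0, -ρ, 0]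

/-- The generating matrices of the Valentiner group. -/
def generators : Fin 9 → Matrix (Fin 3) (Fin 3) ℂ :=
  ![matZ₁, matZ₂, matZ₃, matT₁, matT₂, matT₃, matT₄, matP, matQ]

lemma det_generators (i : Fin 9) : (generators i).det = 1 := by
  fin_cases i
  all_goals simp [generators, matZ₁, matZ₂, matZ₃, matT₁, matT₂, matT₃, matT₄, Matrix.det_fin_three]
  · simp [matP, τ_inv]
    linear_combination (3 / 4) * τ_sq
  · simp [matQ]
    linear_combination ρ_pow_three

/-- The projective Valentiner group `𝒱 = ⟨𝒯, P, Q⟩` in `PGL₃(ℂ)`. -/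
def valentinerGroup : Subgroup (Matrix.ProjGenLinGroup (Fin 3) ℂ) :=
  Subgroup.closure (Set.range fun i : Fin 9 =>
    Matrix.ProjGenLinGroup.mk
      (Matrix.GeneralLinearGroup.mkOfDetNeZero (generators i)
        (by rw [det_generators]; exact one_ne_zero)))

/-- The group `𝒱_{3·360}`: the preimage of the projective Valentiner group in `SU₃`. -/
def valentinerLift : Subgroup (GL (Fin 3) ℂ) :=
  ((valentinerGroup.comap Matrix.ProjGenLinGroup.mk).comap
    (Matrix.specialUnitaryGroup (Fin 3) ℂ).subtype.toHomUnits).map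
      (Matrix.specialUnitaryGroup (Fin 3) ℂ).subtype.toHomUnits

/-- Membership in `𝒱_{3·360}`, spelled out. -/
lemma mem_valentinerLift (g : GL (Fin 3) ℂ) :
    g ∈ valentinerLift ↔
      g.val ∈ Matrix.specialUnitaryGroup (Fin 3) ℂ ∧
        Matrix.ProjGenLinGroup.mk g ∈ valentinerGroup := by
  constructor
  · rintro ⟨u, hu, rfl⟩
    exact ⟨u.2, hu⟩
  · rintro ⟨h1, h2⟩
    have e : (Matrix.specialUnitaryGroup (Fin 3) ℂ).subtype.toHomUnits ⟨g.val, h1⟩ = g :=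
      Units.ext rfl
    refine ⟨⟨g.val, h1⟩, ?_, e⟩
    change Matrix.ProjGenLinGroup.mk
      ((Matrix.specialUnitaryGroup (Fin 3) ℂ).subtype.toHomUnits ⟨g.val, h1⟩) ∈ valentinerGroup
    rwa [e]

end

end Valentiner

/-! The result is Molien's formula for forms, evaluated on an explicit finite group. The dimension
of the invariants is the average over the group of the traces on homogeneous forms. If `T` has
eigenvalues `d i`, the traces on `p`-forms have generating function `e_p(d⁻¹) / ∏ (1 - (d i)⁻¹ t)`
(`exists_mk_trace_homRep`). For a finite-order element of `SU₃` this depends only on the trace `a`,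
because the elementary symmetric functions of the inverse eigenvalues are `1`, `star a`, `a`, `1`
(`mk_trace_homRep_three`).

The group is described by 1080 = 6·5·4·3·3 products of words, built along scalars, tetrahedral,
icosahedral and Valentiner groups. Left multiplication by any group element permutes this family
(`valentinerLift_le_permutingSubgroup`), which is all that averaging needs; distinctness of the
products is never used. Up to powers of `ρ` the traces are `3, -1, 0, 1, τ, 1 - τ`, with
multiplicities `1, 45, 80, 90, 72, 72` modulo scalars (`card_traceClass`). Both facts are finite
computations in `ℤ[ρ, τ]`.

Summing over the three scalar multiples of an element turns each denominator into a cubic in `t ^ 3`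
dividing `(1 - t^6)(1 - t^12)(1 - t^30)`, so the closed form becomes a polynomial identity modulo
`τ² = τ + 1` (`mk_finrank_invForms_mul_denom`). The expansions follow because the denominator is a
unit among power series. -/

namespace Valentiner

/-! ### The representation of `GLₙ(ℂ)` on homogeneous polynomial forms -/

section Forms

open MvPolynomial

variable {n : ℕ}

lemma linSubst_apply (A : Matrix (Fin n) (Fin n) ℂ) (f : MvPolynomial (Fin n) ℂ) :
    linSubst A f = aeval (fun i => ∑ j, C (A i j) * X j) f := rfl

/-- Substitution reverses the order of products; the inverse in `formAct` reverses it again, which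
makes `formAct` a left action. -/
lemma linSubst_mul (A B : Matrix (Fin n) (Fin n) ℂ) (f : MvPolynomial (Fin n) ℂ) :
    linSubst (A * B) f = linSubst B (linSubst A f) := by
  have key : aeval (fun i => ∑ j, C ((A * B) i j) * X j) =
      (aeval fun i => ∑ j, C (B i j) * X j).comp
        (aeval fun i => ∑ j, C (A i j) * (X j : MvPolynomial (Fin n) ℂ)) := by
    refine algHom_ext fun i => ?_
    simp only [aeval_X, AlgHom.comp_apply, map_sum, map_mul, Matrix.mul_apply, Finset.sum_mul,
      Finset.mul_sum, algHom_C, algebraMap_eq]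
    rw [Finset.sum_comm]
    exact Finset.sum_congr rfl fun j _ => Finset.sum_congr rfl fun k _ => mul_assoc _ _ _
  exact DFunLike.congr_fun key f

lemma linSubst_one (f : MvPolynomial (Fin n) ℂ) : linSubst 1 f = f := by
  rw [linSubst_apply]
  have : (fun i : Fin n => ∑ j, C ((1 : Matrix (Fin n) (Fin n) ℂ) i j) * X j) =
      (X : Fin n → MvPolynomial (Fin n) ℂ) := by
    funext i
    simp [Matrix.one_apply]
  rw [this, aeval_X_left_apply]

lemma isHomogeneous_linSubst (A : Matrix (Fin n) (Fin n) ℂ) {f : MvPolynomial (Fin n) ℂ} {m : ℕ}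
    (hf : f.IsHomogeneous m) : (linSubst A f).IsHomogeneous m := by
  have h := hf.aeval (fun i => ∑ j, C (A i j) * X j) (n := 1) fun i =>
    IsHomogeneous.sum _ _ _ fun j _ => by
      simpa using (isHomogeneous_C (Fin n) (A i j)).mul (isHomogeneous_X ℂ j)
  rwa [one_mul] at h

lemma coeff_linSubst_diagonal (c : Fin n → ℂ) (f : MvPolynomial (Fin n) ℂ) (a : Fin n →₀ ℕ) :
    coeff a (linSubst (Matrix.diagonal c) f) = (∏ i, c i ^ a i) * coeff a f := by
  have e : ∀ b : Fin n →₀ ℕ, ∀ r : ℂ,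
      linSubst (Matrix.diagonal c) (monomial b r) = monomial b ((∏ i, c i ^ b i) * r) := by
    intro b r
    have : (fun i : Fin n => ∑ j, C (Matrix.diagonal c i j) * X j) =
        fun i => (C (c i) * X i : MvPolynomial (Fin n) ℂ) := by
      funext i
      rw [Finset.sum_eq_single i] <;> simp +contextual [eq_comm]
    rw [linSubst_apply, this, aeval_monomial, monomial_eq, Finsupp.prod_fintype _ _ (by simp),
      Finsupp.prod_fintype _ _ (by simp)]
    simp only [mul_pow, Finset.prod_mul_distrib, algebraMap_eq, map_mul, map_prod, map_pow]
    ring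
  induction f using MvPolynomial.induction_on' with
  | monomial b r =>
    rw [e, coeff_monomial, coeff_monomial]
    split_ifs with h
    · rw [h]
    · simp
  | add f g hf hg => rw [map_add, coeff_add, coeff_add, hf, hg, mul_add]

lemma formAct_apply {p : ℕ} (T : GL (Fin n) ℂ) (α : PolyForm n p) (v : Fin p → Fin n → ℂ) :
    formAct T α v = linSubst (T⁻¹).val (α fun i => (T⁻¹).val.mulVec (v i)) := rfl

/-- The `p`-forms on `ℂⁿ` whose coefficients are homogeneous polynomials of degree `m`. -/
def homForms (n p m : ℕ) : Submodule ℂ (PolyForm n p) where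
  carrier := {α | ∀ v, (α v).IsHomogeneous m}
  zero_mem' _ := isHomogeneous_zero _ _ _
  add_mem' h k v := (h v).add (k v)
  smul_mem' c _ h v := (homogeneousSubmodule (Fin n) ℂ m).smul_mem c (h v)

lemma formAct_one {p : ℕ} (α : PolyForm n p) : formAct 1 α = α := by
  ext1 v
  rw [formAct_apply, inv_one, Units.val_one, linSubst_one]
  simp only [Matrix.one_mulVec]

lemma formAct_mul {p : ℕ} (S T : GL (Fin n) ℂ) (α : PolyForm n p) :
    formAct (S * T) α = formAct S (formAct T α) := by
  ext1 v
  simp only [formAct_apply, mul_inv_rev, Units.val_mul, linSubst_mul, Matrix.mulVec_mulVec]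

lemma formAct_add {p : ℕ} (T : GL (Fin n) ℂ) (α β : PolyForm n p) :
    formAct T (α + β) = formAct T α + formAct T β := by
  ext1 v
  simp only [formAct_apply, AlternatingMap.add_apply, map_add]

lemma formAct_smul {p : ℕ} (T : GL (Fin n) ℂ) (c : ℂ) (α : PolyForm n p) :
    formAct T (c • α) = c • formAct T α := by
  ext1 v
  simp only [formAct_apply, AlternatingMap.smul_apply, map_smul]

/-- The representation of `GLₙ(ℂ)` on the `p`-forms with homogeneous coefficients of degree `m`. -/
noncomputable def homRep (n p m : ℕ) : Representation ℂ (GL (Fin n) ℂ) (homForms n p m) where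
  toFun T :=
    { toFun := fun α => ⟨formAct T α.1, fun _ => isHomogeneous_linSubst _ (α.2 _)⟩
      map_add' := fun α β => Subtype.ext (formAct_add T α.1 β.1)
      map_smul' := fun c α => Subtype.ext (formAct_smul T c α.1) }
  map_one' := LinearMap.ext fun α => Subtype.ext (formAct_one α.1)
  map_mul' S T := LinearMap.ext fun α => Subtype.ext (formAct_mul S T α.1)

open Set.powersetCard in
/-- Coordinates of a polynomial form: its values at the increasing tuples of basis vectors. -/
noncomputable def formCoord (n p : ℕ) :
    PolyForm n p ≃ₗ[ℂ] (Set.powersetCard (Fin n) p → MvPolynomial (Fin n) ℂ) :=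
  exteriorPower.alternatingMapLinearEquiv ≪≫ₗ
    (((Pi.basisFun ℂ (Fin n)).exteriorPower p).constr ℂ).symm

lemma formCoord_apply {p : ℕ} (α : PolyForm n p) (s : Set.powersetCard (Fin n) p) :
    formCoord n p α s =
      α fun i => Pi.single (Set.powersetCard.ofFinEmbEquiv.symm s i) (1 : ℂ) := by
  rw [formCoord, LinearEquiv.trans_apply]
  refine (congrArg (exteriorPower.alternatingMapLinearEquiv α)
    (exteriorPower.basis_apply ℂ p (Pi.basisFun ℂ (Fin n)) s)).trans ?_
  rw [exteriorPower.ιMulti_family, exteriorPower.alternatingMapLinearEquiv_apply_ιMulti]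
  congr 1
  funext i
  simp

/-- Every value of the form is a complex linear combination of its coordinates `F s`, and
homogeneous polynomials of degree `m` form a subspace. -/
lemma formCoord_symm_mem_homForms {p m : ℕ}
    {F : Set.powersetCard (Fin n) p → MvPolynomial (Fin n) ℂ} (hF : ∀ s, (F s).IsHomogeneous m) :
    (formCoord n p).symm F ∈ homForms n p m := by
  intro v
  have h : (formCoord n p).symm F v =
      ((Pi.basisFun ℂ (Fin n)).exteriorPower p).constr ℂ F (exteriorPower.ιMulti ℂ p v) :=
    exteriorPower.alternatingMapLinearEquiv_symm_apply _ _
  have hm := LinearMap.mem_range_self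
    (((Pi.basisFun ℂ (Fin n)).exteriorPower p).constr ℂ F) (exteriorPower.ιMulti ℂ p v)
  rw [Module.Basis.constr_range] at hm
  rw [h, ← mem_homogeneousSubmodule]
  refine Submodule.span_le.2 ?_ hm
  rintro _ ⟨s, rfl⟩
  exact hF s

/-- The index set of the monomial basis of `homForms n p m`. -/
abbrev homIndex (n p m : ℕ) : Type :=
  Set.powersetCard (Fin n) p × (Finset.finsuppAntidiag (Finset.univ : Finset (Fin n)) m)

/-- The coordinates of a homogeneous form in the monomial basis. -/
noncomputable def homCoordMap (n p m : ℕ) : homForms n p m →ₗ[ℂ] (homIndex n p m → ℂ) :=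
  LinearMap.pi fun k => lcoeff ℂ k.2.1 ∘ₗ LinearMap.proj k.1 ∘ₗ (formCoord n p).toLinearMap ∘ₗ
    (homForms n p m).subtype

lemma homCoordMap_apply {p m : ℕ} (α : homForms n p m) (k : homIndex n p m) :
    homCoordMap n p m α k = coeff k.2.1 (formCoord n p α.1 k.1) := rfl

lemma mem_finsuppAntidiag_univ {a : Fin n →₀ ℕ} {m : ℕ} :
    a ∈ Finset.finsuppAntidiag (Finset.univ : Finset (Fin n)) m ↔ a.degree = m := by
  rw [Finset.mem_finsuppAntidiag, Finsupp.degree_eq_sum]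
  simp

lemma homCoordMap_bijective (n p m : ℕ) : Function.Bijective (homCoordMap n p m) := by
  constructor
  · intro α β hαβ
    refine Subtype.ext ((formCoord n p).injective ?_)
    funext s
    ext a
    by_cases ha : a.degree = m
    · exact congrFun hαβ (s, ⟨a, mem_finsuppAntidiag_univ.2 ha⟩)
    · rw [formCoord_apply, formCoord_apply, (α.2 _).coeff_eq_zero ha, (β.2 _).coeff_eq_zero ha]
  · intro g
    refine ⟨⟨(formCoord n p).symm fun s => ∑ a, monomial a.1 (g (s, a)),
      formCoord_symm_mem_homForms fun s => IsHomogeneous.sum _ _ _ fun a _ =>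
        isHomogeneous_monomial _ (mem_finsuppAntidiag_univ.1 a.2)⟩, ?_⟩
    funext k
    rw [homCoordMap_apply, LinearEquiv.apply_symm_apply, coeff_sum,
      Finset.sum_eq_single k.2]
    · simp
    · intro b _ hb
      rw [coeff_monomial, if_neg fun h => hb (Subtype.ext h)]
    · simp

/-- The space of homogeneous forms in the coordinates of the monomial basis. -/
noncomputable def homCoord (n p m : ℕ) : homForms n p m ≃ₗ[ℂ] (homIndex n p m → ℂ) :=
  LinearEquiv.ofBijective (homCoordMap n p m) (homCoordMap_bijective n p m)

instance (n p m : ℕ) : FiniteDimensional ℂ (homForms n p m) :=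
  (homCoord n p m).symm.finiteDimensional

lemma trace_eq_sum_of_coord {V K : Type*} [AddCommMonoid V] [Module ℂ V] [Fintype K]
    (e : V ≃ₗ[ℂ] (K → ℂ)) (f : V →ₗ[ℂ] V) (c : K → ℂ) (h : ∀ v k, e (f v) k = c k * e v k) :
    LinearMap.trace ℂ V f = ∑ k, c k := by
  classical
  rw [LinearMap.trace_eq_matrix_trace ℂ (Module.Basis.ofEquivFun e), Matrix.trace]
  refine Finset.sum_congr rfl fun k _ => ?_
  simp [LinearMap.toMatrix_apply, h]

/-- The diagonal matrix with non-zero diagonal entries, as an element of `GLₙ(ℂ)`. -/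
noncomputable def diagGL (d : Fin n → ℂ) (hd : ∀ i, d i ≠ 0) : GL (Fin n) ℂ where
  val := Matrix.diagonal d
  inv := Matrix.diagonal fun i => (d i)⁻¹
  val_inv := by simp [hd]
  inv_val := by simp [hd]

/-- The monomial forms `x^a dx_s` are eigenvectors of diagonal matrices; the inverses come from
pulling back along `T⁻¹`. -/
lemma homCoord_homRep_diagGL {p m : ℕ} (d : Fin n → ℂ) (hd : ∀ i, d i ≠ 0) (α : homForms n p m)
    (k : homIndex n p m) :
    homCoord n p m (homRep n p m (diagGL d hd) α) k =
      ((∏ i ∈ k.1.1, (d i)⁻¹) * ∏ i, (d i)⁻¹ ^ k.2.1 i) * homCoord n p m α k := by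
  obtain ⟨s, a, ha⟩ := k
  change coeff a (formCoord n p (formAct (diagGL d hd) α.1) s) = _ * coeff a (formCoord n p α.1 s)
  have hprod : ∏ i ∈ s.1, (d i)⁻¹ = ∏ i, (d (Set.powersetCard.ofFinEmbEquiv.symm s i))⁻¹ := by
    rw [Set.powersetCard.ofFinEmbEquiv_symm_apply,
      ← Finset.prod_image (f := fun i => (d i)⁻¹) (s := Finset.univ)
        (g := Finset.orderEmbOfFin s.val s.prop) (by simp [Set.InjOn])]
    congr 1
    apply Finset.coe_injective
    rw [Finset.coe_image, Finset.coe_univ, Set.image_univ]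
    exact (Finset.range_orderEmbOfFin s.1 s.2).symm
  have hv : ∀ i : Fin n, ((diagGL d hd)⁻¹).val.mulVec (Pi.single i (1 : ℂ)) =
      (d i)⁻¹ • Pi.single i (1 : ℂ) := by
    intro i
    change (Matrix.diagonal fun i => (d i)⁻¹).mulVec _ = _
    rw [Matrix.mulVec_single_one]
    ext j
    by_cases h : j = i
    · subst h; simp
    · simp [h, Matrix.diagonal_apply_ne]
  rw [formCoord_apply, formCoord_apply, formAct_apply]
  simp only [hv]
  rw [AlternatingMap.map_smul_univ, map_smul, coeff_smul,
    show ((diagGL d hd)⁻¹).val = Matrix.diagonal fun i => (d i)⁻¹ from rfl,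
    coeff_linSubst_diagonal, hprod, smul_eq_mul, mul_assoc]

lemma trace_homRep_diagGL {p m : ℕ} (d : Fin n → ℂ) (hd : ∀ i, d i ≠ 0) :
    LinearMap.trace ℂ _ (homRep n p m (diagGL d hd)) =
      (∑ s ∈ Finset.powersetCard p Finset.univ, ∏ i ∈ s, (d i)⁻¹) *
        ∑ a ∈ Finset.finsuppAntidiag Finset.univ m, ∏ i, (d i)⁻¹ ^ a i := by
  refine (trace_eq_sum_of_coord (homCoord n p m) _ _ (homCoord_homRep_diagGL d hd)).trans ?_
  rw [Fintype.sum_prod_type, Finset.sum_mul_sum,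
    Finset.sum_subtype (p := (· ∈ Set.powersetCard (Fin n) p)) _
      (fun s => by simp [Finset.mem_powersetCard, Set.powersetCard.mem_iff])]
  exact Finset.sum_congr rfl fun s _ => Finset.sum_coe_sort (Finset.finsuppAntidiag _ m)
    fun a : Fin n →₀ ℕ => (∏ i ∈ s.1, (d i)⁻¹) * ∏ i, (d i)⁻¹ ^ a i

/-- Molien's formula for a diagonal matrix. -/
lemma mk_trace_homRep_diagGL (p : ℕ) (d : Fin n → ℂ) (hd : ∀ i, d i ≠ 0) :
    PowerSeries.mk (fun m => LinearMap.trace ℂ _ (homRep n p m (diagGL d hd))) *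
      ∏ i, (1 - PowerSeries.C (d i)⁻¹ * PowerSeries.X) =
      PowerSeries.C (∑ s ∈ Finset.powersetCard p Finset.univ, ∏ i ∈ s, (d i)⁻¹) := by
  -- The sum over exponents of total degree `m` is the `m`-th coefficient of a product of geometric
  -- series.
  have h : PowerSeries.mk (fun m => LinearMap.trace ℂ _ (homRep n p m (diagGL d hd))) =
      PowerSeries.C (∑ s ∈ Finset.powersetCard p Finset.univ, ∏ i ∈ s, (d i)⁻¹) *
      ∏ i, PowerSeries.mk fun k => (d i)⁻¹ ^ k := by
    ext m
    rw [PowerSeries.coeff_C_mul, PowerSeries.coeff_prod]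
    simp only [PowerSeries.coeff_mk]
    exact trace_homRep_diagGL d hd
  rw [h, mul_assoc, ← Finset.prod_mul_distrib, Finset.prod_eq_one, mul_one]
  intro i _
  ext (_ | m)
  · simp
  · rw [mul_sub, mul_one, map_sub, ← mul_assoc, PowerSeries.coeff_succ_mul_X, mul_comm,
      PowerSeries.coeff_C_mul, PowerSeries.coeff_mk, PowerSeries.coeff_mk, pow_succ', sub_self]
    simp

end Forms

/-! ### Diagonalizing matrices of finite order. -/

section Diagonalization

variable {n : ℕ}

/-- A complex matrix of finite order is diagonalizable. -/
lemma exists_eq_conj_diagGL (T : GL (Fin n) ℂ) {N : ℕ} (hN : N ≠ 0) (hT : T ^ N = 1) :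
    ∃ (U : GL (Fin n) ℂ) (d : Fin n → ℂ) (hd : ∀ i, d i ≠ 0), T = U * diagGL d hd * U⁻¹ := by
  set f : Module.End ℂ (Fin n → ℂ) := Matrix.toLin' T.val with hf
  have hfN : f ^ N = 1 := by
    rw [hf, ← Matrix.toLin'_pow, ← Units.val_pow_eq_pow_val, hT, Units.val_one, Matrix.toLin'_one]
    rfl
  -- `X ^ N - 1` is separable, so `f` is semisimple; over `ℂ` its eigenvectors then span, and a
  -- basis can be selected among them.
  have hss : f.IsSemisimple := by
    refine Module.End.isSemisimple_of_squarefree_aeval_eq_zero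
      (p := Polynomial.X ^ N - 1) ?_ (by simp [hfN])
    exact ((Polynomial.X_pow_sub_one_separable_iff).2 (by exact_mod_cast hN)).squarefree
  have htop : Submodule.span ℂ {v | ∃ μ : ℂ, f v = μ • v} = ⊤ := by
    rw [eq_top_iff, ← hss.iSup_eigenspace_eq_top]
    refine iSup_le fun μ v hv => Submodule.subset_span ⟨μ, ?_⟩
    exact Module.End.mem_eigenspace_iff.1 hv
  obtain ⟨b, hb, hspan, hli⟩ := exists_linearIndependent ℂ {v | ∃ μ : ℂ, f v = μ • v}
  obtain ⟨B, hB⟩ : ∃ B : Module.Basis b ℂ (Fin n → ℂ), ∀ i, B i = i :=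
    ⟨Module.Basis.mk hli (by rw [Subtype.range_coe, hspan, htop]), fun i => by simp⟩
  have : Fintype b := FiniteDimensional.fintypeBasisIndex B
  have hcard : Fintype.card b = n := by
    rw [← Module.finrank_eq_card_basis B]; simp
  let e : b ≃ Fin n := Fintype.equivFinOfCardEq hcard
  let B' := B.reindex e
  have hB' : ∀ i, ∃ μ : ℂ, f (B' i) = μ • B' i := fun i => by
    rw [Module.Basis.reindex_apply, hB]
    exact hb (e.symm i).2
  choose d hd using hB'
  have hd0 : ∀ i, d i ≠ 0 := by
    intro i h
    have h1 : (f ^ N) (B' i) = B' i := by rw [hfN]; rfl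
    obtain ⟨k, rfl⟩ := Nat.exists_eq_succ_of_ne_zero hN
    rw [pow_succ, Module.End.mul_apply, hd, h, zero_smul, map_zero] at h1
    exact B'.ne_zero i h1.symm
  let U : GL (Fin n) ℂ := ⟨(Pi.basisFun ℂ (Fin n)).toMatrix B', B'.toMatrix (Pi.basisFun ℂ (Fin n)),
    Module.Basis.toMatrix_mul_toMatrix_flip _ _, Module.Basis.toMatrix_mul_toMatrix_flip _ _⟩
  refine ⟨U, d, hd0, eq_mul_inv_of_mul_eq (Units.ext ?_)⟩
  change T.val * (Pi.basisFun ℂ (Fin n)).toMatrix B' =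
    (Pi.basisFun ℂ (Fin n)).toMatrix B' * Matrix.diagonal d
  ext i j
  rw [Matrix.mul_diagonal]
  have := congrFun (hd j) i
  rw [hf, Matrix.toLin'_apply] at this
  simpa [Matrix.mulVec, dotProduct, Matrix.mul_apply, Module.Basis.toMatrix_apply, mul_comm]
    using this

lemma trace_representation_conj {Γ V : Type*} [Group Γ] [AddCommGroup V] [Module ℂ V]
    (π : Representation ℂ Γ V) (g h : Γ) :
    LinearMap.trace ℂ V (π (g * h * g⁻¹)) = LinearMap.trace ℂ V (π h) := by
  rw [map_mul, LinearMap.trace_mul_comm, ← map_mul, inv_mul_cancel_left]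

/-- Molien's formula for a matrix of finite order: the generating function of the traces on the
homogeneous `p`-forms, in terms of a diagonal form of the matrix. -/
lemma exists_mk_trace_homRep (T : GL (Fin n) ℂ) {N : ℕ} (hN : N ≠ 0) (hT : T ^ N = 1) :
    ∃ (d : Fin n → ℂ), (∀ i, d i ≠ 0) ∧ T.val.trace = ∑ i, d i ∧ T⁻¹.val.trace = ∑ i, (d i)⁻¹ ∧
      T.val.det = ∏ i, d i ∧ ∀ p,
    PowerSeries.mk (fun m => LinearMap.trace ℂ _ (homRep n p m T)) *
      ∏ i, (1 - PowerSeries.C (d i)⁻¹ * PowerSeries.X) =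
      PowerSeries.C (∑ s ∈ Finset.powersetCard p Finset.univ, ∏ i ∈ s, (d i)⁻¹) := by
  obtain ⟨U, d, hd, rfl⟩ := exists_eq_conj_diagGL T hN hT
  refine ⟨d, hd, ?_, ?_, ?_, fun p => ?_⟩
  · rw [Units.val_mul, Matrix.trace_mul_comm, ← Units.val_mul, inv_mul_cancel_left]
    exact Matrix.trace_diagonal d
  · rw [mul_inv_rev, inv_inv, mul_inv_rev, Units.val_mul, Matrix.trace_mul_comm, ← Units.val_mul,
      inv_mul_cancel_right]
    exact Matrix.trace_diagonal fun i => (d i)⁻¹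
  · rw [Units.val_mul, Matrix.det_mul, mul_comm, ← Matrix.det_mul, ← Units.val_mul,
      inv_mul_cancel_left]
    exact Matrix.det_diagonal
  · rw [← mk_trace_homRep_diagGL p d hd]
    exact congrArg (fun F => PowerSeries.mk F * ∏ i, (1 - PowerSeries.C (d i)⁻¹ * PowerSeries.X))
      (funext fun m => trace_representation_conj (V := homForms n p m) (homRep n p m) U _)

end Diagonalization

/-! ### Invariants as an average of traces. -/

section Averaging

variable {n : ℕ}

/-- The transformations that permute a family of matrices by left multiplication. -/
def permutingSubgroup {Γ ι : Type*} [Group Γ] (f : ι → Γ) : Subgroup Γ where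
  carrier := {g | ∃ σ : Equiv.Perm ι, ∀ i, g * f i = f (σ i)}
  one_mem' := ⟨1, fun i => one_mul _⟩
  mul_mem' := by
    rintro g h ⟨σ, hσ⟩ ⟨π, hπ⟩
    exact ⟨σ * π, fun i => by rw [mul_assoc, hπ, hσ, Equiv.Perm.mul_apply]⟩
  inv_mem' := by
    rintro g ⟨σ, hσ⟩
    refine ⟨σ⁻¹, fun i => ?_⟩
    simp [inv_mul_eq_iff_eq_mul, hσ]

/-- Multiplication by `g` carries block `k` to block `σ k`, and the hypothesis says that it acts
inside the block through a permutation of `f`. -/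
lemma mem_permutingSubgroup_prod {Γ ι κ : Type*} [Group Γ] {f : ι → Γ} {r : κ → Γ} {g : Γ}
    (σ : Equiv.Perm κ) (h : ∀ k, (r (σ k))⁻¹ * g * r k ∈ permutingSubgroup f) :
    g ∈ permutingSubgroup fun i : κ × ι => r i.1 * f i.2 := by
  choose π hπ using h
  refine ⟨Equiv.prodShear σ π, fun ⟨k, i⟩ => ?_⟩
  simp only [Equiv.prodShear_apply]
  rw [← hπ]
  group

/-- A power of `g` that permutes the indices trivially fixes some `f i`, and `f i` cancels. -/
lemma exists_pow_eq_one_of_mem_permutingSubgroup {Γ ι : Type*} [Group Γ] [Finite ι] [Nonempty ι]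
    {f : ι → Γ} {g : Γ} (hg : g ∈ permutingSubgroup f) : ∃ N ≠ 0, g ^ N = 1 := by
  obtain ⟨σ, hσ⟩ := hg
  have h : ∀ k i, g ^ k * f i = f ((σ ^ k) i) := by
    intro k
    induction k with
    | zero => simp
    | succ k ih => intro i; rw [pow_succ', mul_assoc, ih, hσ, pow_succ', Equiv.Perm.mul_apply]
  refine ⟨orderOf σ, (orderOf_pos σ).ne', ?_⟩
  obtain ⟨i⟩ := ‹Nonempty ι›
  have := h (orderOf σ) i
  rwa [pow_orderOf_eq_one, Equiv.Perm.one_apply, mul_eq_right] at this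

/-- The dimension of the space of invariants is an average of traces, taken over any finite family
of group elements that the group permutes by left multiplication. -/
lemma card_mul_finrank_invariants {ι Γ V : Type*} [Fintype ι] [Nonempty ι] [Group Γ]
    [AddCommGroup V] [Module ℂ V] [FiniteDimensional ℂ V] (π : Representation ℂ Γ V)
    {G : Subgroup Γ} {f : ι → Γ} (hf : ∀ i, f i ∈ G) (hG : G ≤ permutingSubgroup f)
    {W : Submodule ℂ V} (hW : ∀ v, v ∈ W ↔ ∀ T ∈ G, π T v = v) :
    (Fintype.card ι : ℂ) * Module.finrank ℂ W = ∑ i, LinearMap.trace ℂ V (π (f i)) := by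
  have hι : (Fintype.card ι : ℂ) ≠ 0 := Nat.cast_ne_zero.2 Fintype.card_ne_zero
  let E : V →ₗ[ℂ] V := (Fintype.card ι : ℂ)⁻¹ • ∑ i, π (f i)
  have hE : ∀ v, E v = (Fintype.card ι : ℂ)⁻¹ • ∑ i, π (f i) v := fun v => by
    simp [E]
  -- The averaging operator projects onto the invariants, so its trace is their dimension. A group
  -- element only reorders the summands, even if `f` has repetitions.
  have hproj : LinearMap.IsProj W E := by
    constructor
    · intro v
      refine (hW _).2 fun T hT => ?_
      obtain ⟨σ, hσ⟩ := hG hT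
      rw [hE, map_smul, map_sum]
      congr 1
      rw [← Equiv.sum_comp σ fun i => π (f i) v]
      refine Finset.sum_congr rfl fun i _ => ?_
      rw [← hσ, map_mul, Module.End.mul_apply]
    · intro v hv
      rw [hE]
      have : ∀ i, π (f i) v = v := fun i => (hW v).1 hv (f i) (hf i)
      simp only [this, Finset.sum_const, Finset.card_univ, ← Nat.cast_smul_eq_nsmul ℂ, smul_smul,
        inv_mul_cancel₀ hι, one_smul]
  rw [← hproj.trace, map_smul, map_sum, smul_eq_mul, mul_inv_cancel_left₀ hι]

/-- The invariants are viewed inside the finite-dimensional space `homForms n p m`, where traces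
make sense. -/
lemma card_mul_finrank_invForms {ι : Type*} [Fintype ι] [Nonempty ι] {G : Subgroup (GL (Fin n) ℂ)}
    {f : ι → GL (Fin n) ℂ} (hf : ∀ i, f i ∈ G) (hG : G ≤ permutingSubgroup f) (p m : ℕ) :
    (Fintype.card ι : ℂ) * Module.finrank ℂ (invForms G p m) =
      ∑ i, LinearMap.trace ℂ _ (homRep n p m (f i)) := by
  have hle : invForms G p m ≤ homForms n p m := fun α hα => hα.1
  have hW : ∀ α : homForms n p m, α ∈ (invForms G p m).submoduleOf (homForms n p m) ↔
      ∀ T ∈ G, homRep n p m T α = α := fun α =>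
    ⟨fun hα T hT => Subtype.ext (hα.2 T hT),
      fun hα => ⟨α.2, fun T hT => congrArg Subtype.val (hα T hT)⟩⟩
  have h := card_mul_finrank_invariants (V := homForms n p m) (homRep n p m) hf hG hW
  have e : Module.finrank ℂ ((invForms G p m).submoduleOf (homForms n p m)) =
    Module.finrank ℂ (invForms G p m) := (Submodule.submoduleOfEquivOfLe hle).finrank_eq
  rw [← e]
  exact h

end Averaging

/-! ### Words in the generators, and exact arithmetic in `ℤ[ρ, τ]` -/

section Arithmetic

lemma ρ_primitive : IsPrimitiveRoot ρ 3 := by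
  have h := Complex.isPrimitiveRoot_exp 3 (by norm_num)
  rwa [show (2 * Real.pi * Complex.I / (3 : ℕ) : ℂ) = 2 * Real.pi * Complex.I / 3 by norm_num] at h

lemma ρ_sq : ρ ^ 2 = -1 - ρ := by
  have h := ρ_primitive.geom_sum_eq_zero (by norm_num)
  simp only [Finset.sum_range_succ, Finset.sum_range_zero] at h
  linear_combination h

lemma ρ_ne_zero : ρ ≠ 0 := ρ_primitive.ne_zero (by norm_num)

lemma star_ρ : star ρ = ρ ^ 2 := by
  have h : star ρ * ρ = 1 := by
    rw [Complex.star_def, ← Complex.normSq_eq_conj_mul_self, Complex.normSq_eq_norm_sq,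
      ρ_primitive.norm'_eq_one (by norm_num)]
    norm_num
  have h3 := ρ_pow_three
  linear_combination ρ ^ 2 * h - star ρ * h3

lemma star_τ : star τ = τ := Complex.conj_ofReal _

/-- The element `a + b ρ + c τ + d ρ τ` of `ℤ[ρ, τ]`. -/
structure Quad where
  (a b c d : ℤ)
deriving DecidableEq

namespace Quad

/-- The complex value of an element of `ℤ[ρ, τ]`. -/
noncomputable def val (x : Quad) : ℂ := x.a + x.b * ρ + x.c * τ + x.d * (ρ * τ)

/-- Addition in `ℤ[ρ, τ]`. -/
def add (x y : Quad) : Quad := ⟨x.a + y.a, x.b + y.b, x.c + y.c, x.d + y.d⟩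

/-- Negation in `ℤ[ρ, τ]`. -/
def neg (x : Quad) : Quad := ⟨-x.a, -x.b, -x.c, -x.d⟩

/-- Multiplication by an integer in `ℤ[ρ, τ]`. -/
def smul (n : ℤ) (x : Quad) : Quad := ⟨n * x.a, n * x.b, n * x.c, n * x.d⟩

/-- Multiplication by `ρ`. -/
def mulρ (x : Quad) : Quad := ⟨-x.b, x.a - x.b, -x.d, x.c - x.d⟩

/-- Multiplication by `τ`. -/
def mulτ (x : Quad) : Quad := ⟨x.c, x.d, x.a + x.c, x.b + x.d⟩

lemma val_add (x y : Quad) : (x.add y).val = x.val + y.val := by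
  simp only [val, add]; push_cast; ring

lemma val_neg (x : Quad) : x.neg.val = -x.val := by
  simp only [val, neg]; push_cast; ring

lemma val_smul (n : ℤ) (x : Quad) : (x.smul n).val = n * x.val := by
  simp only [val, smul]; push_cast; ring

lemma val_mulρ (x : Quad) : x.mulρ.val = ρ * x.val := by
  simp only [val, mulρ]; push_cast; linear_combination -(x.b + x.d * τ) * ρ_sq

lemma val_mulτ (x : Quad) : x.mulτ.val = τ * x.val := by
  simp only [val, mulτ]; push_cast; linear_combination -(x.c + x.d * ρ) * τ_sq

end Quad

/-- A vector with entries in `ℤ[ρ, τ]`. -/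
structure Vec where
  (x y z : Quad)
deriving DecidableEq

namespace Vec

/-- The complex vector given by a vector over `ℤ[ρ, τ]`. -/
noncomputable def val (v : Vec) : Fin 3 → ℂ := ![v.x.val, v.y.val, v.z.val]

/-- Multiplication of a vector by an integer. -/
def smul (n : ℤ) (v : Vec) : Vec := ⟨v.x.smul n, v.y.smul n, v.z.smul n⟩

lemma val_smul (n : ℤ) (v : Vec) : (v.smul n).val = (n : ℂ) • v.val := by
  ext i
  fin_cases i <;> simp [val, smul, Quad.val_smul]

/-- The standard basis of `ℤ[ρ, τ]³`. -/
def single : Fin 3 → Vec :=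
  ![⟨⟨1, 0, 0, 0⟩, ⟨0, 0, 0, 0⟩, ⟨0, 0, 0, 0⟩⟩, ⟨⟨0, 0, 0, 0⟩, ⟨1, 0, 0, 0⟩, ⟨0, 0, 0, 0⟩⟩,
    ⟨⟨0, 0, 0, 0⟩, ⟨0, 0, 0, 0⟩, ⟨1, 0, 0, 0⟩⟩]

lemma val_single (i : Fin 3) : (single i).val = Pi.single i 1 := by
  ext j
  fin_cases i <;> fin_cases j <;> simp [single, val, Quad.val]

end Vec

/-- The generators of the Valentiner group, as elements of `GL₃(ℂ)`. -/
noncomputable def genGL (i : Fin 9) : GL (Fin 3) ℂ :=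
  Matrix.GeneralLinearGroup.mkOfDetNeZero (generators i)
    (by rw [det_generators]; exact one_ne_zero)

lemma genGL_val (i : Fin 9) : (genGL i).val = generators i := rfl

/-- The scalar transformation `ρ`. -/
noncomputable def scalarρ : GL (Fin 3) ℂ := .scalar (Fin 3) (Units.mk0 ρ ρ_ne_zero)

lemma scalarρ_val : scalarρ.val = Matrix.scalar (Fin 3) ρ := rfl

/-- Letters for a set of generators of `𝒱_{3·360}`: `Z₁`, `T₁`, `P`, `Q` and the scalar `ρ`. -/
inductive Letter
  | Z | T | P | Q | R
deriving DecidableEq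

namespace Letter

/-- The transformation denoted by a letter. -/
noncomputable def gl : Letter → GL (Fin 3) ℂ
  | Z => genGL 0
  | T => genGL 3
  | P => genGL 7
  | Q => genGL 8
  | R => scalarρ

/-- The power of two that makes the matrix of a letter integral. -/
def twos : Letter → ℕ
  | P => 1
  | _ => 0

/-- The action of a letter, multiplied by its power of two, on vectors over `ℤ[ρ, τ]`. -/
def act : Letter → Vec → Vec
  | Z, v => ⟨v.x, v.y.neg, v.z.neg⟩
  | T, v => ⟨v.z, v.x, v.y⟩
  -- The rows of `2P`, with `τ⁻¹` written as `τ - 1`.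
  | P, ⟨x, y, z⟩ => ⟨x.add ((y.mulτ.add y.neg).add z.mulτ.neg),
      (x.mulτ.add x.neg).add (y.mulτ.add z), x.mulτ.add (y.neg.add (z.mulτ.add z.neg))⟩
  | Q, v => ⟨v.x, v.z.mulρ.mulρ, v.y.mulρ.neg⟩
  | R, v => ⟨v.x.mulρ, v.y.mulρ, v.z.mulρ⟩

lemma val_act (l : Letter) (v : Vec) :
    (l.act v).val = (2 : ℂ) ^ l.twos • l.gl.val.mulVec v.val := by
  obtain ⟨x, y, z⟩ := v
  cases l
  all_goals
    ext i
    fin_cases i <;>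
    simp [act, twos, gl, Vec.val, genGL_val, generators, scalarρ_val, matZ₁, matT₁, matP, matQ,
      Quad.val_add, Quad.val_neg, Quad.val_mulρ,
      Quad.val_mulτ, τ_inv, -neg_mul]
  all_goals ring

end Letter

/-- The transformation denoted by a word. -/
noncomputable def wordGL (w : List Letter) : GL (Fin 3) ℂ := (w.map Letter.gl).prod

/-- The power of two that makes the matrix of a word integral. -/
def wordTwos (w : List Letter) : ℕ := (w.map Letter.twos).sum

/-- The action of a word, multiplied by its power of two, on vectors over `ℤ[ρ, τ]`. -/
def wordAct (w : List Letter) (v : Vec) : Vec := w.foldr Letter.act v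

lemma wordGL_append (w w' : List Letter) : wordGL (w ++ w') = wordGL w * wordGL w' := by
  simp [wordGL]

lemma val_wordAct (w : List Letter) (v : Vec) :
    (wordAct w v).val = (2 : ℂ) ^ wordTwos w • (wordGL w).val.mulVec v.val := by
  induction w with
  | nil => simp [wordAct, wordTwos, wordGL]
  | cons l w ih =>
    rw [show wordAct (l :: w) v = l.act (wordAct w v) from rfl, Letter.val_act, ih,
      Matrix.mulVec_smul, smul_smul, Matrix.mulVec_mulVec]
    simp [wordTwos, wordGL, pow_add]

/-- A computable criterion for two words to denote the same transformation. -/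
abbrev SameWord (w w' : List Letter) : Prop :=
  ∀ i, (wordAct w (Vec.single i)).smul (2 ^ wordTwos w') =
    (wordAct w' (Vec.single i)).smul (2 ^ wordTwos w)

/-- Images of the standard basis are compared after cross-multiplying by powers of two. Only this
direction is needed, so `Quad.val` need not be injective. -/
lemma SameWord.wordGL_eq {w w' : List Letter} (h : SameWord w w') : wordGL w = wordGL w' := by
  refine Units.ext (Matrix.ext_of_mulVec_single fun i => ?_)
  have h' := congrArg Vec.val (h i)
  rw [Vec.val_smul, Vec.val_smul, val_wordAct, val_wordAct, Vec.val_single, smul_smul, smul_smul,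
    mul_comm] at h'
  push_cast at h'
  exact smul_right_injective _
    (mul_ne_zero (pow_ne_zero _ two_ne_zero) (pow_ne_zero _ two_ne_zero)) h'

/-- The trace of a word, multiplied by its power of two. -/
def wordTrace (w : List Letter) : Quad :=
  ((wordAct w (Vec.single 0)).x.add (wordAct w (Vec.single 1)).y).add (wordAct w (Vec.single 2)).z

lemma val_wordTrace (w : List Letter) :
    (wordTrace w).val = 2 ^ wordTwos w * (wordGL w).val.trace := by
  have h : ∀ i, (wordAct w (Vec.single i)).val i = 2 ^ wordTwos w * (wordGL w).val i i := by
    intro i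
    rw [val_wordAct, Vec.val_single]
    simp
  rw [wordTrace, Quad.val_add, Quad.val_add, Matrix.trace_fin_three, mul_add, mul_add, ← h, ← h,
    ← h]
  rfl

end Arithmetic

/-! ### The elements of the group -/

section Elements

open Letter

lemma wordGL_mem_permutingSubgroup {ι : Type*} {f : ι → GL (Fin 3) ℂ} {S : List Letter}
    (hS : ∀ l ∈ S, l.gl ∈ permutingSubgroup f) {w : List Letter} (hw : ∀ l ∈ w, l ∈ S) :
    wordGL w ∈ permutingSubgroup f := by
  refine Subgroup.list_prod_mem _ fun g hg => ?_
  obtain ⟨l, hl, rfl⟩ := List.mem_map.1 hg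
  exact hS l (hw l hl)

/-- The family of all products of an element denoted by one of the words `r k` with an element of
the family `f`. -/
noncomputable def extend {ι κ : Type*} (r : κ → List Letter) (f : ι → GL (Fin 3) ℂ) (i : κ × ι) :
    GL (Fin 3) ℂ := wordGL (r i.1) * f i.2

/-- This is one row of a coset table: `l` sends the coset of `r k` to that of `r (σ k)`, and the
correction `w k` is a word in letters already known to permute `f`. -/
lemma gl_mem_permutingSubgroup_extend {ι κ : Type*} {f : ι → GL (Fin 3) ℂ} {S : List Letter}
    (hS : ∀ l ∈ S, l.gl ∈ permutingSubgroup f) (l : Letter) (r : κ → List Letter)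
    (σ : Equiv.Perm κ) (w : κ → List Letter) (hw : ∀ k, ∀ l ∈ w k, l ∈ S)
    (h : ∀ k, SameWord (l :: r k) (r (σ k) ++ w k)) :
    l.gl ∈ permutingSubgroup (extend r f) := by
  refine mem_permutingSubgroup_prod (r := fun k => wordGL (r k)) σ fun k => ?_
  have e := (h k).wordGL_eq
  rw [wordGL_append, show wordGL (l :: r k) = l.gl * wordGL (r k) by simp [wordGL]] at e
  rw [mul_assoc, e, inv_mul_cancel_left]
  exact wordGL_mem_permutingSubgroup hS (hw k)

/-- Words for the scalars in the group. -/
def wordsR (k : Fin 3) : List Letter := List.replicate k .R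

/-- Words for representatives of the tetrahedral group modulo its Klein four-group. -/
def wordsT (k : Fin 3) : List Letter := List.replicate k .T

/-- Words for the Klein four-group. -/
def wordsZ : Fin 4 → List Letter := ![[], [.Z], [.T, .Z, .T, .T], [.T, .T, .Z, .T]]

/-- Words for representatives of the icosahedral group modulo the tetrahedral group. -/
def wordsP (k : Fin 5) : List Letter := List.replicate k .P

/-- Words for representatives of the Valentiner group modulo the icosahedral group. -/
def wordsQ : Fin 6 → List Letter :=
  ![[.Q], [.P, .Q], [.P, .P, .Q], [.P, .P, .P, .Q], [.P, .P, .P, .P, .Q], []]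

/-- The scalars in the group. -/
noncomputable abbrev familyR : Fin 3 × Unit → GL (Fin 3) ℂ := extend wordsR fun _ => 1

/-- The scalars, and representatives of the tetrahedral group modulo its Klein four-group. -/
noncomputable abbrev familyT : Fin 3 × Fin 3 × Unit → GL (Fin 3) ℂ := extend wordsT familyR

/-- The tetrahedral group, with scalars. -/
noncomputable abbrev familyZ : Fin 4 × Fin 3 × Fin 3 × Unit → GL (Fin 3) ℂ := extend wordsZ familyT

/-- The icosahedral group, with scalars. -/
noncomputable abbrev familyP : Fin 5 × Fin 4 × Fin 3 × Fin 3 × Unit → GL (Fin 3) ℂ :=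
  extend wordsP familyZ

/-- The elements of `𝒱_{3·360}`. -/
noncomputable abbrev familyQ : Fin 6 × Fin 5 × Fin 4 × Fin 3 × Fin 3 × Unit → GL (Fin 3) ℂ :=
  extend wordsQ familyP

lemma mem_permutingSubgroup_familyR : ∀ l ∈ [R], l.gl ∈ permutingSubgroup familyR := by
  simp only [List.mem_singleton, forall_eq]
  exact gl_mem_permutingSubgroup_extend (S := []) (by simp) R wordsR (finRotate 3) (fun _ => [])
    (by decide) (by decide +kernel)

lemma mem_permutingSubgroup_familyT : ∀ l ∈ [T, R], l.gl ∈ permutingSubgroup familyT := by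
  simp only [List.forall_mem_cons]
  refine ⟨?_, ?_, by simp⟩
  · exact gl_mem_permutingSubgroup_extend mem_permutingSubgroup_familyR T wordsT (finRotate 3)
      (fun _ => []) (by decide) (by decide +kernel)
  · exact gl_mem_permutingSubgroup_extend mem_permutingSubgroup_familyR R wordsT 1
      (fun _ => [R]) (by decide) (by decide +kernel)

lemma mem_permutingSubgroup_familyZ : ∀ l ∈ [Z, T, R], l.gl ∈ permutingSubgroup familyZ := by
  simp only [List.forall_mem_cons]
  refine ⟨?_, ?_, ?_, by simp⟩
  · exact gl_mem_permutingSubgroup_extend mem_permutingSubgroup_familyT Z wordsZ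
      -- Here and below, a permutation is given by its table followed by the table of its inverse.
      ⟨![1, 0, 3, 2], ![1, 0, 3, 2], by decide, by decide⟩ (fun _ => [])
      (by decide) (by decide +kernel)
  · exact gl_mem_permutingSubgroup_extend mem_permutingSubgroup_familyT T wordsZ
      ⟨![0, 2, 3, 1], ![0, 3, 1, 2], by decide, by decide⟩ (fun _ => [T])
      (by decide) (by decide +kernel)
  · exact gl_mem_permutingSubgroup_extend mem_permutingSubgroup_familyT R wordsZ 1
      (fun _ => [R]) (by decide) (by decide +kernel)

lemma mem_permutingSubgroup_familyP : ∀ l ∈ [P, Z, T, R], l.gl ∈ permutingSubgroup familyP := by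
  simp only [List.forall_mem_cons]
  refine ⟨?_, ?_, ?_, ?_, by simp⟩
  · exact gl_mem_permutingSubgroup_extend mem_permutingSubgroup_familyZ P wordsP (finRotate 5)
      (fun _ => []) (by decide) (by decide +kernel)
  · exact gl_mem_permutingSubgroup_extend mem_permutingSubgroup_familyZ Z wordsP
      ⟨![0, 3, 4, 1, 2], ![0, 3, 4, 1, 2], by decide, by decide⟩
      ![[.Z], [.T, .T, .Z, .T, .T, .T], [.T, .T, .Z, .T, .T], [.Z, .T], [.T, .Z, .T, .T, .T, .T]]
      (by decide) (by decide +kernel)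
  · exact gl_mem_permutingSubgroup_extend mem_permutingSubgroup_familyZ T wordsP
      ⟨![0, 3, 2, 4, 1], ![0, 4, 2, 1, 3], by decide, by decide⟩
      ![[.T], [.T, .Z, .T, .T, .T], [.Z, .T, .T], [.T, .Z, .T, .T], [.T, .T]]
      (by decide) (by decide +kernel)
  · exact gl_mem_permutingSubgroup_extend mem_permutingSubgroup_familyZ R wordsP 1
      (fun _ => [R]) (by decide) (by decide +kernel)

lemma mem_permutingSubgroup_familyQ (l : Letter) : l.gl ∈ permutingSubgroup familyQ := by
  cases l
  · exact gl_mem_permutingSubgroup_extend mem_permutingSubgroup_familyP Z wordsQ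
      ⟨![0, 3, 4, 1, 2, 5], ![0, 3, 4, 1, 2, 5], by decide, by decide⟩
      ![[.Z], [.R, .R, .T, .T, .Z, .T, .T], [.R, .Z, .T, .T], [.R, .T, .Z, .T, .T, .T, .T],
        [.R, .R, .T, .Z, .T, .T, .T], [.Z]] (by decide) (by decide +kernel)
  · exact gl_mem_permutingSubgroup_extend mem_permutingSubgroup_familyP T wordsQ
      ⟨![0, 3, 2, 4, 1, 5], ![0, 4, 2, 1, 3, 5], by decide, by decide⟩
      ![[.R, .T, .T, .Z, .T, .T, .T], [.R, .T, .T], [.R, .R, .T], [.T, .T, .Z, .T],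
        [.R, .R, .Z, .T], [.T]] (by decide) (by decide +kernel)
  · exact gl_mem_permutingSubgroup_extend mem_permutingSubgroup_familyP P wordsQ
      -- `P` rotates the five cosets of the `P ^ j Q` and fixes the icosahedral coset, which is
      -- listed last.
      ⟨![1, 2, 3, 4, 0, 5], ![4, 0, 1, 2, 3, 5], by decide, by decide⟩
      ![[], [], [], [], [], [.P]] (by decide) (by decide +kernel)
  · exact gl_mem_permutingSubgroup_extend mem_permutingSubgroup_familyP Q wordsQ
      ⟨![5, 2, 3, 4, 1, 0], ![5, 4, 1, 2, 3, 0], by decide, by decide⟩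
      ![[.Z], [.R, .R, .P, .P, .T, .Z, .T, .T, .T], [.P, .Z, .T],
        [.R, .P, .P, .P, .P, .T, .T, .Z, .T, .T, .T], [.P, .P, .P, .T, .T, .Z, .T, .T, .T], []]
      (by decide) (by decide +kernel)
  · exact gl_mem_permutingSubgroup_extend mem_permutingSubgroup_familyP R wordsQ 1
      (fun _ => [R]) (by decide) (by decide +kernel)

lemma gl_mem_valentinerLift (l : Letter) : l.gl ∈ valentinerLift := by
  have hgen : ∀ i, Matrix.ProjGenLinGroup.mk (genGL i) ∈ valentinerGroup := fun i =>
    Subgroup.subset_closure ⟨i, rfl⟩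
  have h3 := ρ_pow_three
  have hτ := τ_sq
  rw [mem_valentinerLift, Matrix.mem_specialUnitaryGroup_iff, Matrix.mem_unitaryGroup_iff']
  cases l
  · refine ⟨⟨?_, det_generators 0⟩, hgen 0⟩
    ext i j
    fin_cases i <;> fin_cases j <;>
      simp [gl, genGL_val, generators, matZ₁, Matrix.mul_apply, Fin.sum_univ_three]
  · refine ⟨⟨?_, det_generators 3⟩, hgen 3⟩
    ext i j
    fin_cases i <;> fin_cases j <;>
      simp [gl, genGL_val, generators, matT₁, Matrix.mul_apply, Fin.sum_univ_three]
  · refine ⟨⟨?_, det_generators 7⟩, hgen 7⟩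
    have hs : (starRingEnd ℂ) τ = τ := star_τ
    have h2 : (starRingEnd ℂ) 2 = 2 := Complex.conj_ofReal 2
    ext i j
    fin_cases i <;> fin_cases j <;>
      simp [gl, genGL_val, generators, matP, Matrix.mul_apply, Fin.sum_univ_three, τ_inv,
        hs, h2] <;>
      first
      | linear_combination (1 / 2 : ℂ) * hτ
      | linear_combination (1 / 4 : ℂ) * hτ
      | linear_combination (-1 / 4 : ℂ) * hτ
  · refine ⟨⟨?_, det_generators 8⟩, hgen 8⟩
    have hs : (starRingEnd ℂ) ρ = ρ ^ 2 := star_ρ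
    ext i j
    fin_cases i <;> fin_cases j <;>
      simp [gl, genGL_val, generators, matQ, Matrix.mul_apply, Fin.sum_univ_three, hs]
    · linear_combination h3
    · linear_combination (ρ ^ 3 + 1) * h3
  · refine ⟨⟨?_, ?_⟩, ?_⟩
    · have hs : (starRingEnd ℂ) ρ = ρ ^ 2 := star_ρ
      ext i j
      fin_cases i <;> fin_cases j <;>
        simp [gl, scalarρ_val, Matrix.mul_apply, Fin.sum_univ_three, hs, ← pow_succ, h3]
    · change scalarρ.val.det = 1
      simp [scalarρ_val, h3]
    · change Matrix.ProjGenLinGroup.mk scalarρ ∈ _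
      rw [scalarρ, Matrix.ProjGenLinGroup.mk_scalar]
      exact one_mem _

lemma wordGL_mem_valentinerLift (w : List Letter) : wordGL w ∈ valentinerLift := by
  refine Subgroup.list_prod_mem _ fun g hg => ?_
  obtain ⟨l, _, rfl⟩ := List.mem_map.1 hg
  exact gl_mem_valentinerLift l

lemma familyQ_mem_valentinerLift (i) : familyQ i ∈ valentinerLift :=
  mul_mem (wordGL_mem_valentinerLift _) <| mul_mem (wordGL_mem_valentinerLift _) <|
    mul_mem (wordGL_mem_valentinerLift _) <| mul_mem (wordGL_mem_valentinerLift _) <|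
    mul_mem (wordGL_mem_valentinerLift _) (one_mem _)

/-- Words for the generators of the Valentiner group. -/
def wordsGen : Fin 9 → List Letter :=
  ![[.Z], [.T, .Z, .T, .T], [.T, .T, .Z, .T], [.T], [.T, .Z], [.T, .T, .Z, .T, .T],
    [.Z, .T], [.P], [.Q]]

/-- Five letters suffice, since the remaining tetrahedral generators are words in `Z₁` and `T₁`. -/
lemma genGL_eq_wordGL (i : Fin 9) : genGL i = wordGL (wordsGen i) := by
  refine Units.ext (Matrix.ext_of_mulVec_single fun j => ?_)
  have h : (2 : ℂ) ^ wordTwos (wordsGen i) • (genGL i).val.mulVec (Pi.single j 1) =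
      (wordAct (wordsGen i) (Vec.single j)).val := by
    fin_cases i <;> fin_cases j <;> ext k <;> fin_cases k <;>
      simp [genGL_val, generators, wordsGen, wordAct, wordTwos, Letter.act, Letter.twos, Vec.single,
        Vec.val, Quad.val, Quad.add, Quad.neg, Quad.mulρ, Quad.mulτ, matZ₁, matZ₂, matZ₃, matT₁,
        matT₂, matT₃, matT₄, matP, matQ, τ_inv]
    all_goals first | linear_combination ρ_sq | ring
  rw [val_wordAct, Vec.val_single] at h
  exact smul_right_injective _ (pow_ne_zero _ two_ne_zero) h

lemma wordGL_mem_permutingSubgroup_familyQ (w : List Letter) :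
    wordGL w ∈ permutingSubgroup familyQ :=
  wordGL_mem_permutingSubgroup (S := w) (fun l _ => mem_permutingSubgroup_familyQ l)
    fun _ h => h

/-- An element of the lift is a product of generators and their inverses times a scalar `u`. Both
determinants are `1`, so `u ^ 3 = 1` and the scalar is a power of `ρ`. -/
lemma valentinerLift_le_permutingSubgroup : valentinerLift ≤ permutingSubgroup familyQ := by
  intro g hg
  obtain ⟨hu, hV⟩ := (mem_valentinerLift g).1 hg
  have hmap : valentinerGroup =
      (Subgroup.closure (Set.range genGL)).map Matrix.ProjGenLinGroup.mk := by
    rw [MonoidHom.map_closure, ← Set.range_comp]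
    rfl
  rw [hmap] at hV
  obtain ⟨h, hh, hgh⟩ := hV
  have hle : Subgroup.closure (Set.range genGL) ≤
      permutingSubgroup familyQ ⊓ (Matrix.GeneralLinearGroup.det : GL (Fin 3) ℂ →* ℂˣ).ker := by
    rw [Subgroup.closure_le]
    rintro _ ⟨i, rfl⟩
    refine ⟨?_, Units.ext (det_generators i)⟩
    rw [genGL_eq_wordGL]
    exact wordGL_mem_permutingSubgroup_familyQ _
  obtain ⟨hperm, hdet⟩ := hle hh
  obtain ⟨u, rfl⟩ := Matrix.ProjGenLinGroup.mk_eq_mk_iff.1 hgh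
  have hu3 : (u : ℂ) ^ 3 = 1 := by
    have h1 : h.val.det = 1 := congrArg Units.val hdet
    have h2 := (Matrix.mem_specialUnitaryGroup_iff.1 hu).2
    simpa [h1] using h2
  obtain ⟨k, -, hk⟩ := ρ_primitive.eq_pow_of_pow_eq_one hu3
  have hscal : Matrix.GeneralLinearGroup.scalar (Fin 3) u = scalarρ ^ k := by
    rw [scalarρ, ← map_pow]
    congr 1
    exact Units.ext hk.symm
  rw [hscal]
  exact mul_mem hperm (pow_mem (mem_permutingSubgroup_familyQ .R) k)

/-- Words for the Valentiner group modulo scalars. -/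
def wordsPSL (i : Fin 6 × Fin 5 × Fin 4 × Fin 3) : List Letter :=
  wordsQ i.1 ++ (wordsP i.2.1 ++ (wordsZ i.2.2.1 ++ wordsT i.2.2.2))

/-- Representatives of the traces of the elements of the Valentiner group, up to powers of `ρ`. -/
def traceReps : Fin 6 → Quad :=
  ![⟨3, 0, 0, 0⟩, ⟨-1, 0, 0, 0⟩, ⟨0, 0, 0, 0⟩, ⟨1, 0, 0, 0⟩, ⟨0, 0, 1, 0⟩, ⟨1, 0, -1, 0⟩]

/-- The trace of the `i`-th element is the `c`-th representative times a power of `ρ`. -/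
abbrev HasTraceClass (i : Fin 6 × Fin 5 × Fin 4 × Fin 3) (c : Fin 6) : Prop :=
  ∃ k : Fin 3, wordTrace (wordsPSL i) =
    (Quad.mulρ^[k] (traceReps c)).smul (2 ^ wordTwos (wordsPSL i))

/-- The class of the trace of the `i`-th element. -/
def traceClass (i : Fin 6 × Fin 5 × Fin 4 × Fin 3) : Fin 6 :=
  if HasTraceClass i 0 then 0 else if HasTraceClass i 1 then 1 else if HasTraceClass i 2 then 2
  else if HasTraceClass i 3 then 3 else if HasTraceClass i 4 then 4 else 5

/-- A check of all 360 words; in particular it justifies the default value `5` in `traceClass`. -/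
lemma hasTraceClass_traceClass : ∀ i, HasTraceClass i (traceClass i) := by
  decide +kernel

/-- These match the numbers of elements of `A₆` of order 1, 2, 3 and 4 and of its two classes of
order 5. -/
lemma card_traceClass : ∀ c, (Finset.univ.filter fun i => traceClass i = c).card =
    (![1, 45, 80, 90, 72, 72] : Fin 6 → ℕ) c := by
  decide +kernel

end Elements

/-! ### The Molien series -/

section Molien

open PowerSeries

/-- The trace on the `p`-th exterior power of `(ℂ³)*` of an element of `SU₃` of trace `a`. -/
noncomputable def extTrace (p : Fin 4) (a : ℂ) : ℂ := ![1, star a, a, 1] p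

/-- The reversed characteristic polynomial of the inverse of an element of `SU₃` of trace `a`. -/
noncomputable def revCharpoly (a : ℂ) : ℂ⟦X⟧ := 1 - C (star a) * X + C a * X ^ 2 - X ^ 3

lemma constantCoeff_revCharpoly (a : ℂ) : constantCoeff (revCharpoly a) = 1 := by
  simp [revCharpoly]

/-- The contribution of an element of `SU₃` of trace `a` to the Molien series of `p`-forms. -/
noncomputable def molienTerm (p : Fin 4) (a : ℂ) : ℂ⟦X⟧ := C (extTrace p a) * (revCharpoly a)⁻¹

/-- Unitarity makes the sum of the inverse eigenvalues `star a`. Determinant one makes each product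
of two inverse eigenvalues equal to the third eigenvalue, so these products sum to `a`. -/
lemma mk_trace_homRep_three {T : GL (Fin 3) ℂ} (hT : T ∈ valentinerLift) (p : Fin 4) :
    (PowerSeries.mk fun m => LinearMap.trace ℂ _ (homRep 3 p m T)) = molienTerm p T.val.trace := by
  obtain ⟨hu, hdet⟩ := Matrix.mem_specialUnitaryGroup_iff.1 ((mem_valentinerLift T).1 hT).1
  obtain ⟨N, hN, hTN⟩ :=
    exists_pow_eq_one_of_mem_permutingSubgroup (valentinerLift_le_permutingSubgroup hT)
  obtain ⟨d, hd, htr, htr', hd', h⟩ := exists_mk_trace_homRep T hN hTN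
  have hstar : T⁻¹.val = star T.val := by
    have h1 : star T.val * T.val = 1 := Matrix.mem_unitaryGroup_iff'.1 hu
    calc T⁻¹.val = star T.val * T.val * T⁻¹.val := by rw [h1, one_mul]
      _ = star T.val := by rw [mul_assoc, ← Units.val_mul, mul_inv_cancel, Units.val_one, mul_one]
  have hs : star T.val.trace = ∑ i, (d i)⁻¹ := by
    rw [← htr', hstar, Matrix.star_eq_conjTranspose, Matrix.trace_conjTranspose]
  rw [hdet, Fin.prod_univ_three] at hd'
  rw [Fin.sum_univ_three] at hs htr
  have h0 := hd 0
  have h1 := hd 1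
  have h2 := hd 2
  have hinv : (d 0)⁻¹ * (d 1)⁻¹ * (d 2)⁻¹ = 1 := by rw [← mul_inv, ← mul_inv, ← hd', inv_one]
  have h01 : (d 0)⁻¹ * (d 1)⁻¹ = d 2 := by field_simp; linear_combination hd'
  have h02 : (d 0)⁻¹ * (d 2)⁻¹ = d 1 := by field_simp; linear_combination hd'
  have h12 : (d 1)⁻¹ * (d 2)⁻¹ = d 0 := by field_simp; linear_combination hd'
  have htr2 : T.val.trace = (d 0)⁻¹ * (d 1)⁻¹ + (d 0)⁻¹ * (d 2)⁻¹ + (d 1)⁻¹ * (d 2)⁻¹ := by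
    rw [htr, h01, h02, h12]
    ring
  have hprod : ∏ i, (1 - C (d i)⁻¹ * X) = revCharpoly T.val.trace := by
    rw [revCharpoly, hs, htr2, Fin.prod_univ_three]
    have hC := congrArg (C : ℂ →+* ℂ⟦X⟧) hinv
    simp only [map_mul, map_add, map_one] at hC ⊢
    linear_combination -X ^ 3 * hC
  have hsum : ∑ s ∈ Finset.powersetCard (p : ℕ) Finset.univ, ∏ i ∈ s, (d i)⁻¹ =
      extTrace p T.val.trace := by
    fin_cases p
    · simp [extTrace]
    · simp [extTrace, hs, Finset.powersetCard_one, Fin.sum_univ_three]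
    · have : Finset.powersetCard 2 (Finset.univ : Finset (Fin 3)) = {{0, 1}, {0, 2}, {1, 2}} := by
        decide
      simp only [extTrace, this]
      rw [Finset.sum_insert (by decide), Finset.sum_insert (by decide), Finset.sum_singleton,
        Finset.prod_pair (by decide), Finset.prod_pair (by decide), Finset.prod_pair (by decide),
        h01, h02, h12]
      change _ = T.val.trace
      rw [htr]
      ring
    · have : Finset.powersetCard 3 (Finset.univ : Finset (Fin 3)) = {Finset.univ} := by
        decide
      simp only [extTrace, this]
      rw [Finset.sum_singleton, Fin.prod_univ_three, hinv]
      rfl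
  have hp := h p
  rw [hprod, hsum] at hp
  rw [molienTerm, ← hp, mul_assoc, PowerSeries.mul_inv_cancel _ (by
    rw [constantCoeff_revCharpoly]; exact one_ne_zero), mul_one]

/-- The contribution of the three multiples by powers of `ρ` of an element of `SU₃`. -/
noncomputable def molienSum (p : Fin 4) (a : ℂ) : ℂ⟦X⟧ :=
  ∑ k : Fin 3, molienTerm p (ρ ^ (k : ℕ) * a)

/-- The three summands are permuted cyclically, so traces matter only up to powers of `ρ`. -/
lemma molienSum_ρ_mul (p : Fin 4) (a : ℂ) : molienSum p (ρ * a) = molienSum p a := by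
  simp only [molienSum, Fin.sum_univ_three, ← mul_assoc, ← pow_succ]
  norm_num [ρ_pow_three]
  ring

lemma trace_familyQ (q j a b k u) : (familyQ (q, j, a, b, k, u)).val.trace =
    ρ ^ (k : ℕ) * (wordGL (wordsPSL (q, j, a, b))).val.trace := by
  have h : familyQ (q, j, a, b, k, u) = wordGL (wordsPSL (q, j, a, b)) * scalarρ ^ (k : ℕ) := by
    simp only [extend, wordsPSL, wordGL_append, mul_assoc, mul_one]
    congr 4
    simp [wordGL, wordsR, Letter.gl]
  have h' : (scalarρ ^ (k : ℕ)).val = Matrix.scalar (Fin 3) (ρ ^ (k : ℕ)) := by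
    rw [Units.val_pow_eq_pow_val, scalarρ_val, ← map_pow]
  rw [h, Units.val_mul, h', Matrix.scalar_apply, ← Matrix.smul_one_eq_diagonal, Matrix.mul_smul,
    mul_one,
    Matrix.trace_smul, smul_eq_mul]

lemma val_iterate_mulρ (k : ℕ) (x : Quad) : (Quad.mulρ^[k] x).val = ρ ^ k * x.val := by
  induction k with
  | zero => simp
  | succ k ih => rw [Function.iterate_succ_apply', Quad.val_mulρ, ih, pow_succ']; ring

lemma molienSum_trace_wordsPSL (p : Fin 4) (i) :
    molienSum p (wordGL (wordsPSL i)).val.trace = molienSum p (traceReps (traceClass i)).val := by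
  obtain ⟨k, hk⟩ := hasTraceClass_traceClass i
  have h := congrArg Quad.val hk
  rw [val_wordTrace, Quad.val_smul, val_iterate_mulρ] at h
  push_cast at h
  rw [mul_right_injective₀ (pow_ne_zero _ two_ne_zero) h]
  clear hk h
  generalize (k : ℕ) = k
  induction k with
  | zero => simp
  | succ k ih => rw [pow_succ', mul_assoc, molienSum_ρ_mul, ih]

/-- The sum over the 1080 products is grouped first by scalars, giving `molienSum`, and then by
trace class. -/
lemma mk_finrank_invForms (p : Fin 4) :
    (1080 : ℂ⟦X⟧) * PowerSeries.mk (fun m => (Module.finrank ℂ (invForms valentinerLift p m) : ℂ)) =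
      molienSum p 3 + 45 * molienSum p (-1) + 80 * molienSum p 0 + 90 * molienSum p 1 +
        72 * molienSum p τ + 72 * molienSum p (1 - τ) := by
  have h1 : (1080 : ℂ⟦X⟧) *
      PowerSeries.mk (fun m => (Module.finrank ℂ (invForms valentinerLift p m) : ℂ)) =
      ∑ i, molienTerm p (familyQ i).val.trace := by
    ext m
    rw [show (1080 : ℂ⟦X⟧) = C (1080 : ℂ) from (map_ofNat C 1080).symm, coeff_C_mul, coeff_mk]
    have := card_mul_finrank_invForms familyQ_mem_valentinerLift valentinerLift_le_permutingSubgroup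
      p m
    simp only [Fintype.card_prod, Fintype.card_fin, Fintype.card_unit] at this
    norm_num at this
    rw [this, map_sum]
    refine Finset.sum_congr rfl fun i _ => ?_
    rw [← mk_trace_homRep_three (familyQ_mem_valentinerLift i), coeff_mk]
  have h2 : ∑ i, molienTerm p (familyQ i).val.trace =
      ∑ i, molienSum p (traceReps (traceClass i)).val := by
    have h3 := fun i => (molienSum_trace_wordsPSL p i).symm
    simp only [h3]
    simp only [molienSum, Fintype.sum_prod_type, trace_familyQ]
    simp
  rw [h1, h2, ← Finset.sum_fiberwise' _ traceClass fun c => molienSum p (traceReps c).val]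
  simp only [Finset.sum_const, card_traceClass, Fin.sum_univ_six]
  simp [traceReps, Quad.val, sub_eq_add_neg]

end Molien

/-! ### Evaluating the sum over the common denominator. -/

section Evaluation

open PowerSeries

lemma star_ρ_mul {a : ℂ} (ha : star a = a) : star (ρ * a) = (-1 - ρ) * a := by
  rw [star_mul', star_ρ, ha, ρ_sq]

lemma star_ρ_sq_mul {a : ℂ} (ha : star a = a) : star (ρ ^ 2 * a) = ρ * a := by
  rw [star_mul', star_pow, star_ρ, ha, ← pow_mul]
  linear_combination ρ * a * ρ_pow_three

lemma revCharpoly_real {a : ℂ} (ha : star a = a) :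
    revCharpoly a = 1 - C a * X + C a * X ^ 2 - X ^ 3 := by
  rw [revCharpoly, ha]

lemma revCharpoly_ρ_mul {a : ℂ} (ha : star a = a) :
    revCharpoly (ρ * a) = 1 - (-1 - C ρ) * C a * X + C ρ * C a * X ^ 2 - X ^ 3 := by
  rw [revCharpoly, star_ρ_mul ha]
  simp only [map_mul, map_sub, map_neg, map_one]

lemma revCharpoly_ρ_sq_mul {a : ℂ} (ha : star a = a) :
    revCharpoly (ρ ^ 2 * a) = 1 - C ρ * C a * X + (-1 - C ρ) * C a * X ^ 2 - X ^ 3 := by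
  rw [revCharpoly, star_ρ_sq_mul ha, ρ_sq]
  simp only [map_mul, map_sub, map_neg, map_one]

lemma C_ρ_sq : (C ρ : ℂ⟦X⟧) ^ 2 + C ρ + 1 = 0 := by
  rw [← map_pow, ρ_sq, map_sub, map_neg, map_one]
  ring

/-- The product of the reversed characteristic polynomials of the multiples by powers of `ρ`. -/
lemma prod_revCharpoly {a : ℂ} (ha : star a = a) :
    revCharpoly a * revCharpoly (ρ * a) * revCharpoly (ρ ^ 2 * a) =
      1 - (C a ^ 3 - 3 * C a ^ 2 + 3) * X ^ 3 + (C a ^ 3 - 3 * C a ^ 2 + 3) * X ^ 6 - X ^ 9 := by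
  -- Scaling the eigenvalues by cube roots of unity leaves only powers of `X ^ 3`. The coefficient
  -- is the power sum `e₁³ - 3e₁e₂ + 3e₃` with `e₁ = e₂ = a` and `e₃ = 1`, the trace of the cube.
  rw [revCharpoly_real ha, revCharpoly_ρ_mul ha, revCharpoly_ρ_sq_mul ha]
  linear_combination -(C a * X + C a * X ^ 2) ^ 2 *
    (1 - C a * X + C a * X ^ 2 - X ^ 3) * C_ρ_sq

/-- The numerators of the sums of Molien terms. -/
noncomputable def molienNum (p : Fin 4) (a : ℂ⟦X⟧) : ℂ⟦X⟧ :=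
  ![3 * ((1 - X ^ 3) ^ 2 + a ^ 2 * X ^ 3), 3 * a * (a ^ 2 * X ^ 2 - a * X ^ 2 * (1 - X ^ 3)),
    3 * a * (a ^ 2 * X ^ 4 + a * X * (1 - X ^ 3)), 3 * ((1 - X ^ 3) ^ 2 + a ^ 2 * X ^ 3)] p

/-- Clearing denominators leaves in each term the product of the other two factors; the sum is then
reduced by `ρ² + ρ + 1 = 0`. -/
lemma molienSum_mul_prod (p : Fin 4) {a : ℂ} (ha : star a = a) :
    molienSum p a * (revCharpoly a * revCharpoly (ρ * a) * revCharpoly (ρ ^ 2 * a)) =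
      molienNum p (C a) := by
  have hinv : ∀ b, (revCharpoly b)⁻¹ * revCharpoly b = 1 := fun b =>
    PowerSeries.inv_mul_cancel _ (by rw [constantCoeff_revCharpoly]; exact one_ne_zero)
  have e : molienSum p a * (revCharpoly a * revCharpoly (ρ * a) * revCharpoly (ρ ^ 2 * a)) =
      C (extTrace p a) * (revCharpoly (ρ * a) * revCharpoly (ρ ^ 2 * a)) +
      C (extTrace p (ρ * a)) * (revCharpoly a * revCharpoly (ρ ^ 2 * a)) +
      C (extTrace p (ρ ^ 2 * a)) * (revCharpoly a * revCharpoly (ρ * a)) := by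
    simp only [molienSum, Fin.sum_univ_three, molienTerm]
    norm_num
    linear_combination
      C (extTrace p a) * (revCharpoly (ρ * a) * revCharpoly (ρ ^ 2 * a)) * hinv a +
      C (extTrace p (ρ * a)) * (revCharpoly a * revCharpoly (ρ ^ 2 * a)) * hinv (ρ * a) +
      C (extTrace p (ρ ^ 2 * a)) * (revCharpoly a * revCharpoly (ρ * a)) * hinv (ρ ^ 2 * a)
  rw [e, revCharpoly_real ha, revCharpoly_ρ_mul ha, revCharpoly_ρ_sq_mul ha]
  have h := C_ρ_sq
  fin_cases p
  · simp [extTrace, molienNum]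
    linear_combination -(C a * X + C a * X ^ 2) ^ 2 * h
  · simp only [extTrace, molienNum, ha, star_ρ_mul ha, star_ρ_sq_mul ha]
    simp
    linear_combination C a * (-(C a * X + C a * X ^ 2) ^ 2 +
      (1 - C a * X + C a * X ^ 2 - X ^ 3) * (2 * (C a * X ^ 2) + 2 * (C a * X))) * h
  · simp [extTrace, molienNum, ρ_sq]
    linear_combination C a * (-(C a * X + C a * X ^ 2) ^ 2 -
      (1 - C a * X + C a * X ^ 2 - X ^ 3) * (2 * (C a * X ^ 2) + 2 * (C a * X))) * h
  · simp [extTrace, molienNum]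
    linear_combination -(C a * X + C a * X ^ 2) ^ 2 * h

/-- The denominator of the Molien series. -/
noncomputable def molienDenom (R : Type*) [CommRing R] : R⟦X⟧ :=
  (1 - X ^ 6) * (1 - X ^ 12) * (1 - X ^ 30)

/-- The numerators of the Molien series. -/
noncomputable def exteriorMolienNum (R : Type*) [CommRing R] (p : Fin 4) : R⟦X⟧ :=
  ![1 + X ^ 45, X ^ 5 + X ^ 11 + X ^ 20 + X ^ 26 + X ^ 29 + X ^ 44,
    X + X ^ 16 + X ^ 19 + X ^ 25 + X ^ 34 + X ^ 40, 1 + X ^ 45] p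

/-- `W` is the cofactor of the cubic in `X ^ 3` inside the common denominator. -/
lemma molienSum_mul_denom (p : Fin 4) {a : ℂ} (ha : star a = a) {W : ℂ⟦X⟧}
    (hW : (1 - (C a ^ 3 - 3 * C a ^ 2 + 3) * X ^ 3 + (C a ^ 3 - 3 * C a ^ 2 + 3) * X ^ 6 - X ^ 9) *
      W = molienDenom ℂ) :
    molienSum p a * molienDenom ℂ = molienNum p (C a) * W := by
  rw [← hW, ← prod_revCharpoly ha, ← mul_assoc, molienSum_mul_prod p ha]

/-- Reducing to first degree in `u` keeps the final identity low in `τ`; it serves for both roots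
`τ` and `1 - τ`. -/
lemma molienNum_golden (p : Fin 4) {u : ℂ⟦X⟧} (hu : u ^ 2 = u + 1) :
    molienNum p u = ![3 * ((1 - X ^ 3) ^ 2 + (u + 1) * X ^ 3), 3 * X ^ 2 * (u + (u + 1) * X ^ 3),
      3 * X * (u + 1 + u * X ^ 3), 3 * ((1 - X ^ 3) ^ 2 + (u + 1) * X ^ 3)] p := by
  fin_cases p
  · change 3 * ((1 - X ^ 3) ^ 2 + u ^ 2 * X ^ 3) = 3 * ((1 - X ^ 3) ^ 2 + (u + 1) * X ^ 3)
    rw [hu]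
  · simp [molienNum]
    linear_combination 3 * X ^ 2 * ((u + 1) - (1 - X ^ 3)) * hu
  · simp [molienNum]
    linear_combination 3 * X * ((u + 1) * X ^ 3 + (1 - X ^ 3)) * hu
  · change 3 * ((1 - X ^ 3) ^ 2 + u ^ 2 * X ^ 3) = 3 * ((1 - X ^ 3) ^ 2 + (u + 1) * X ^ 3)
    rw [hu]

lemma mk_finrank_invForms_mul_denom (p : Fin 4) :
    PowerSeries.mk (fun m => (Module.finrank ℂ (invForms valentinerLift p m) : ℂ)) *
      molienDenom ℂ = exteriorMolienNum ℂ p := by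
  have ht : (C τ : ℂ⟦X⟧) ^ 2 = C τ + 1 := by rw [← map_pow, τ_sq, map_add, map_one]
  have ht' : (1 - C τ : ℂ⟦X⟧) ^ 2 = 1 - C τ + 1 := by linear_combination ht
  -- With `Y = X ^ 3`, the cubic is `(1 - Y)^3` for traces `3` and `0`, `(1 + Y)(1 - Y²)` for `-1`,
  -- and `(1 - Y)(1 + Y²)` for `1`.
  have e1 := molienSum_mul_denom p (a := 3) (Complex.conj_ofReal 3)
    (W := (1 + X ^ 3) ^ 2 * (1 + X ^ 6) * ∑ i ∈ Finset.range 10, X ^ (3 * i))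
    (by simp only [map_ofNat, molienDenom, Finset.sum_range_succ, Finset.sum_range_zero]; ring)
  have e2 := molienSum_mul_denom p (a := -1) (by simp)
    (W := (1 - X ^ 3) * (1 + X ^ 6) * (1 - X ^ 30))
    (by simp only [map_neg, map_one, molienDenom]; ring)
  have e3 := molienSum_mul_denom p (a := 0) (by simp)
    (W := (1 + X ^ 3) ^ 2 * (1 + X ^ 6) * ∑ i ∈ Finset.range 10, X ^ (3 * i))
    (by simp only [map_zero, molienDenom, Finset.sum_range_succ, Finset.sum_range_zero]; ring)
  have e4 := molienSum_mul_denom p (a := 1) (by simp)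
    (W := (1 + X ^ 3) * (1 - X ^ 6) * (1 - X ^ 30))
    (by simp only [map_one, molienDenom]; ring)
  -- For trace `τ` the cubic is `(1 - Y)(1 + τY + Y²)`. The conjugate factor `1 + (1 - τ)Y + Y²`
  -- completes it to `1 - Y⁵ = 1 - X ^ 15`.
  have e5 := molienSum_mul_denom p (a := τ) star_τ
    (W := (1 - X ^ 6) * (1 - X ^ 12) * (1 + X ^ 15) * (1 + (1 - C τ) * X ^ 3 + X ^ 6))
    (by
      rw [show (C τ : ℂ⟦X⟧) ^ 3 - 3 * C τ ^ 2 + 3 = 1 - C τ by linear_combination (C τ - 2) * ht,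
        molienDenom]
      linear_combination -(1 - X ^ 3) * (1 - X ^ 6) * (1 - X ^ 12) * (1 + X ^ 15) * X ^ 6 * ht)
  have e6 := molienSum_mul_denom p (a := 1 - τ) (by rw [star_sub, star_one, star_τ])
    (W := (1 - X ^ 6) * (1 - X ^ 12) * (1 + X ^ 15) * (1 + C τ * X ^ 3 + X ^ 6))
    (by
      rw [map_sub, map_one, show (1 - C τ : ℂ⟦X⟧) ^ 3 - 3 * (1 - C τ) ^ 2 + 3 = C τ by
        linear_combination (1 - C τ - 2) * ht', molienDenom]
      linear_combination -(1 - X ^ 3) * (1 - X ^ 6) * (1 - X ^ 12) * (1 + X ^ 15) * X ^ 6 * ht)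
  rw [molienNum_golden p ht] at e5
  rw [map_sub, map_one, molienNum_golden p ht'] at e6
  have h := mk_finrank_invForms p
  have h1080 : (1080 : ℂ⟦X⟧) ≠ 0 := by
    rw [← map_ofNat (C : ℂ →+* ℂ⟦X⟧)]
    exact (map_ne_zero_iff _ C_injective).2 (by norm_num)
  refine mul_left_cancel₀ h1080 ?_
  rw [← mul_assoc, h]
  simp only [add_mul, mul_assoc, e2, e3, e4, e5, e6]
  rw [e1]
  simp only [Finset.sum_range_succ, Finset.sum_range_zero, map_ofNat, map_neg, map_one, map_zero]
  -- After adding the two golden contributions only `τ²` has to be reduced. Each contributes its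
  -- square term with weight `72 · 3`, hence the factor `432`.
  fin_cases p
  · simp [molienNum, exteriorMolienNum]
    linear_combination (-432 * X ^ 6 * ((1 - X ^ 6) * (1 - X ^ 12) * (1 + X ^ 15))) * ht
  · simp [molienNum, exteriorMolienNum]
    linear_combination (-432 * X ^ 5 * (1 + X ^ 3) *
      ((1 - X ^ 6) * (1 - X ^ 12) * (1 + X ^ 15))) * ht
  · simp [molienNum, exteriorMolienNum]
    linear_combination (-432 * X ^ 4 * (1 + X ^ 3) *
      ((1 - X ^ 6) * (1 - X ^ 12) * (1 + X ^ 15))) * ht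
  · simp [molienNum, exteriorMolienNum]
    linear_combination (-432 * X ^ 6 * ((1 - X ^ 6) * (1 - X ^ 12) * (1 + X ^ 15))) * ht

/-- The Hilbert series of the invariant `p`-forms of `𝒱_{3·360}`. -/
noncomputable def hilbertSeries (p : ℕ) : ℤ⟦X⟧ :=
  PowerSeries.mk fun m => (Module.finrank ℂ (invForms valentinerLift p m) : ℤ)

lemma hilbertSeries_mul_denom (p : Fin 4) :
    hilbertSeries p * molienDenom ℤ = exteriorMolienNum ℤ p := by
  refine PowerSeries.map_injective (Int.castRingHom ℂ) Int.cast_injective ?_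
  have h1 : PowerSeries.map (Int.castRingHom ℂ) (hilbertSeries p) =
      PowerSeries.mk fun m => (Module.finrank ℂ (invForms valentinerLift p m) : ℂ) := by
    ext m
    simp [hilbertSeries]
  have h2 : PowerSeries.map (Int.castRingHom ℂ) (molienDenom ℤ) = molienDenom ℂ := by
    simp [molienDenom]
  have h3 : PowerSeries.map (Int.castRingHom ℂ) (exteriorMolienNum ℤ p) =
      exteriorMolienNum ℂ p := by
    fin_cases p <;> simp [exteriorMolienNum]
  rw [map_mul, h1, h2, h3, mk_finrank_invForms_mul_denom]

/-- Since `D` is a unit, divisibility of `(H - A) * D` by `X ^ n` passes to `H - A`. An expansion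
can thus be checked by a polynomial identity, without inverting `D`. -/
lemma trunc_eq_of_mul_eq {n : ℕ} {H D E : ℤ⟦X⟧} {A : Polynomial ℤ} (hA : A.natDegree < n)
    (hD : IsUnit D) (h : H * D = (A : ℤ⟦X⟧) * D + X ^ n * E) : trunc n H = A := by
  have hdvd : X ^ n ∣ H - (A : ℤ⟦X⟧) := by
    rw [← hD.dvd_mul_right]
    exact ⟨E, by linear_combination h⟩
  ext m
  rw [coeff_trunc]
  split_ifs with hm
  · have := X_pow_dvd_iff.1 hdvd m hm
    rw [map_sub, Polynomial.coeff_coe] at this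
    linarith
  · rw [Polynomial.coeff_eq_zero_of_natDegree_lt (by omega)]

lemma coe_polynomial_ofNat (n : ℕ) [n.AtLeastTwo] :
    ((ofNat(n) : Polynomial ℤ) : ℤ⟦X⟧) = ofNat(n) :=
  map_ofNat Polynomial.coeToPowerSeries.ringHom n

lemma isUnit_molienDenom : IsUnit (molienDenom ℤ) := by
  rw [isUnit_iff_constantCoeff]
  simp [molienDenom]

lemma exteriorMolienSeries_eq :
    exteriorMolienSeries valentinerLift =
      Polynomial.C (hilbertSeries 0) + Polynomial.C (hilbertSeries 1) * Polynomial.X +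
        Polynomial.C (hilbertSeries 2) * Polynomial.X ^ 2 +
        Polynomial.C (hilbertSeries 3) * Polynomial.X ^ 3 := by
  rw [exteriorMolienSeries, Finset.sum_range_succ, Finset.sum_range_succ, Finset.sum_range_succ,
    Finset.sum_range_succ, Finset.sum_range_zero, zero_add, pow_zero, mul_one, pow_one]
  rfl

lemma coeff_exteriorMolienSeries (p : Fin 4) :
    (exteriorMolienSeries valentinerLift).coeff p = hilbertSeries p := by
  rw [exteriorMolienSeries_eq]
  fin_cases p <;> simp [Polynomial.coeff_X, Polynomial.coeff_X_pow, Polynomial.coeff_C,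
    Polynomial.coeff_C_mul]

end Evaluation

end Valentiner

/-! ### The closed form and the first terms of its expansion. -/

theorem mainTheorem4 :
    let t : PowerSeries ℤ := PowerSeries.X
    let s : Polynomial (PowerSeries ℤ) := Polynomial.X
    let M : Polynomial (PowerSeries ℤ) :=
      Valentiner.exteriorMolienSeries Valentiner.valentinerLift
    let x : Polynomial ℤ := Polynomial.X
    -- the closed form, an identity of fractions written without the denominator
    M * Polynomial.C ((1 - t ^ 6) * (1 - t ^ 12) * (1 - t ^ 30)) =
        Polynomial.C (1 + t ^ 45)
        + Polynomial.C (t ^ 5 + t ^ 11 + t ^ 20 + t ^ 26 + t ^ 29 + t ^ 44) * s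
        + Polynomial.C (t + t ^ 16 + t ^ 19 + t ^ 25 + t ^ 34 + t ^ 40) * s ^ 2
        + Polynomial.C (1 + t ^ 45) * s ^ 3 ∧
    -- the first terms of the coefficients of `s ^ 0`, `s`, `s ^ 2` and `s ^ 3`
    PowerSeries.trunc 31 (M.coeff 0) =
        1 + x ^ 6 + 2 * x ^ 12 + 2 * x ^ 18 + 3 * x ^ 24 + 4 * x ^ 30 ∧
    PowerSeries.trunc 30 (M.coeff 1) =
        x ^ 5 + 2 * x ^ 11 + 3 * x ^ 17 + x ^ 20 + 4 * x ^ 23 + 2 * x ^ 26 + 6 * x ^ 29 ∧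
    PowerSeries.trunc 29 (M.coeff 2) =
        x + x ^ 7 + 2 * x ^ 13 + x ^ 16 + 3 * x ^ 19 + x ^ 22 + 5 * x ^ 25 + 2 * x ^ 28 ∧
    PowerSeries.trunc 31 (M.coeff 3) =
        1 + x ^ 6 + 2 * x ^ 12 + 2 * x ^ 18 + 3 * x ^ 24 + 4 * x ^ 30 := by
  intro t s M x
  have h0 := Valentiner.hilbertSeries_mul_denom 0
  have h1 := Valentiner.hilbertSeries_mul_denom 1
  have h2 := Valentiner.hilbertSeries_mul_denom 2
  have h3 := Valentiner.hilbertSeries_mul_denom 3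
  have c0 : M.coeff 0 = _ := Valentiner.coeff_exteriorMolienSeries 0
  have c1 : M.coeff 1 = _ := Valentiner.coeff_exteriorMolienSeries 1
  have c2 : M.coeff 2 = _ := Valentiner.coeff_exteriorMolienSeries 2
  have c3 : M.coeff 3 = _ := Valentiner.coeff_exteriorMolienSeries 3
  refine ⟨?_, ?_, ?_, ?_, ?_⟩
  · have hM : M = _ := Valentiner.exteriorMolienSeries_eq
    have g0 := congrArg (Polynomial.C : PowerSeries ℤ →+* _) h0
    have g1 := congrArg (Polynomial.C : PowerSeries ℤ →+* _) h1
    have g2 := congrArg (Polynomial.C : PowerSeries ℤ →+* _) h2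
    have g3 := congrArg (Polynomial.C : PowerSeries ℤ →+* _) h3
    rw [Polynomial.C_mul] at g0 g1 g2 g3
    change Polynomial.C (Valentiner.hilbertSeries 0) * Polynomial.C (Valentiner.molienDenom ℤ) =
      Polynomial.C (1 + t ^ 45) at g0
    change Polynomial.C (Valentiner.hilbertSeries 1) * Polynomial.C (Valentiner.molienDenom ℤ) =
      Polynomial.C (t ^ 5 + t ^ 11 + t ^ 20 + t ^ 26 + t ^ 29 + t ^ 44) at g1
    change Polynomial.C (Valentiner.hilbertSeries 2) * Polynomial.C (Valentiner.molienDenom ℤ) =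
      Polynomial.C (t + t ^ 16 + t ^ 19 + t ^ 25 + t ^ 34 + t ^ 40) at g2
    change Polynomial.C (Valentiner.hilbertSeries 3) * Polynomial.C (Valentiner.molienDenom ℤ) =
      Polynomial.C (1 + t ^ 45) at g3
    rw [hM]
    change _ * Polynomial.C (Valentiner.molienDenom ℤ) = _
    linear_combination g0 + s * g1 + s ^ 2 * g2 + s ^ 3 * g3
  · rw [c0]
    -- Here and in the next three cases, `E` is the numerator minus the claimed truncation times the
    -- denominator, divided by the power of `X` at which the series is truncated.
    refine Valentiner.trunc_eq_of_mul_eq (D := Valentiner.molienDenom ℤ) (E :=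
      5 * PowerSeries.X ^ 5 + PowerSeries.X ^ 11 + PowerSeries.X ^ 14 - 4 * PowerSeries.X
      ^ 17 + PowerSeries.X ^ 29 - 5 * PowerSeries.X ^ 35 - 1 * PowerSeries.X ^ 41 + 4 *
      PowerSeries.X ^ 47)
      ?_ Valentiner.isUnit_molienDenom (h0.trans ?_)
    · simp only [x]
      compute_degree!
    · simp [x, Valentiner.molienDenom, Valentiner.exteriorMolienNum,
        Valentiner.coe_polynomial_ofNat]
      ring
  · rw [c1]
    refine Valentiner.trunc_eq_of_mul_eq (D := Valentiner.molienDenom ℤ) (E :=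
      3 * PowerSeries.X ^ 2 + 8 * PowerSeries.X ^ 5 + PowerSeries.X ^ 8 + 3 *
      PowerSeries.X ^ 11 - 1 * PowerSeries.X ^ 14 - 6 * PowerSeries.X ^ 17 + PowerSeries.X
      ^ 20 + PowerSeries.X ^ 26 + PowerSeries.X ^ 29 - 3 * PowerSeries.X ^ 32 - 7 *
      PowerSeries.X ^ 35 - 1 * PowerSeries.X ^ 38 - 2 * PowerSeries.X ^ 41 + 2 *
      PowerSeries.X ^ 44 + 6 * PowerSeries.X ^ 47)
      ?_ Valentiner.isUnit_molienDenom (h1.trans ?_)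
    · simp only [x]
      compute_degree!
    · simp [x, Valentiner.molienDenom, Valentiner.exteriorMolienNum,
        Valentiner.coe_polynomial_ofNat]
      ring
  · rw [c2]
    refine Valentiner.trunc_eq_of_mul_eq (D := Valentiner.molienDenom ℤ) (E :=
      7 * PowerSeries.X ^ 2 + 3 * PowerSeries.X ^ 5 + 2 * PowerSeries.X ^ 8 + 2 *
      PowerSeries.X ^ 11 - 5 * PowerSeries.X ^ 14 - 1 * PowerSeries.X ^ 17 + PowerSeries.X
      ^ 20 + PowerSeries.X ^ 26 - 6 * PowerSeries.X ^ 32 - 2 * PowerSeries.X ^ 35 - 2 *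
      PowerSeries.X ^ 38 - 1 * PowerSeries.X ^ 41 + 5 * PowerSeries.X ^ 44 + 2 *
      PowerSeries.X ^ 47)
      ?_ Valentiner.isUnit_molienDenom (h2.trans ?_)
    · simp only [x]
      compute_degree!
    · simp [x, Valentiner.molienDenom, Valentiner.exteriorMolienNum,
        Valentiner.coe_polynomial_ofNat]
      ring
  · rw [c3]
    refine Valentiner.trunc_eq_of_mul_eq (D := Valentiner.molienDenom ℤ) (E :=
      5 * PowerSeries.X ^ 5 + PowerSeries.X ^ 11 + PowerSeries.X ^ 14 - 4 * PowerSeries.X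
      ^ 17 + PowerSeries.X ^ 29 - 5 * PowerSeries.X ^ 35 - 1 * PowerSeries.X ^ 41 + 4 *
      PowerSeries.X ^ 47)
      ?_ Valentiner.isUnit_molienDenom (h3.trans ?_)
    · simp only [x]
      compute_degree!
    · simp [x, Valentiner.molienDenom, Valentiner.exteriorMolienNum,
        Valentiner.coe_polynomial_ofNat]
      ring
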